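/- **Conventions.** Ideals of $C^*$-algebras are closed and two-sided. For an $A$–$B$ imprimitivity bimodule $X$ and ideals $I\subset A$, $J\subset B$, write $I\cdot X$ and $X\cdot J$ for the closed spans of the products; multipliers of $I$ (of $J$) act on $I\cdot X$ (on $X\cdot J$) by $m\cdot(a\cdot x)=(ma)\cdot x$ and $(x\cdot b)\cdot m=x\cdot(bm)$. A *partial automorphism* of $X$ is a triple $(\alpha,\phi,\beta)$ that is an isomorphism of imprimitivity bimodules between two imprimitivity subbimodules ${}_IY_J$ and ${}_{I'}Y'_{J'}$ of $X$: here $Y,Y'$ are closed subbimodules, $I,J$ (resp. $I',J'$) are the closed spans of their left and right inner products, $\alpha:I\to I'$ and $\beta:J\to J'$ are $*$-isomorphisms, and $\phi:Y\to Y'$ is a bijection compatible, via $\alpha$ and $\beta$, with both module actions and both inner products. A *twisted partial action* $(A,G,\alpha,u)$ of a group $G$ on a $C^*$-algebra $A$ consists of ideals $A_s$, isomorphisms $\alpha_s:A_{s^{-1}}\to A_s$ ($s\in G$) and unitary multipliers $u_{r,s}$ of $A_rA_{rs}$ such that, for all $r,s,t\in G$: $A_e=A$ and $\alpha_e=\mathrm{id}$;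 $\alpha_r(A_{r^{-1}}A_s)=A_rA_{rs}$; $\alpha_r(\alpha_s(a))=u_{r,s}\alpha_{rs}(a)u_{r,s}^*$ for $a\in A_{s^{-1}}A_{s^{-1}r^{-1}}$; $u_{e,t}=u_{t,e}=1$; $\alpha_r(au_{s,t})u_{r,st}=\alpha_r(a)u_{r,s}u_{rs,t}$ for $a\in A_{r^{-1}}A_sA_{st}$. Two such actions $(A,G,\alpha,u)$ and $(B,G,\mu,w)$ are *Morita equivalent*, via $(X,\phi)$, if $X$ is an $A$–$B$ imprimitivity bimodule with $X_s:=A_s\cdot X=X\cdot B_s$ for all $s$, and $\phi_s:X_{s^{-1}}\to X_s$ $(s\in G)$ are maps such that each $(\alpha_s,\phi_s,\mu_s)$ is a partial automorphism of $X$ and $\phi_s\phi_t(x)=u_{s,t}\cdot\phi_{st}(x)\cdot w_{s,t}^*$ for all $s,t\in G$ and $x\in X\cdot B_{t^{-1}s^{-1}}B_{t^{-1}}$. A *Busby–Smith twisted action* $(A,S,\beta,v)$ of a unital inverse semigroup $S$ with unit $e$ consists of ideals $A_s$, isomorphisms $\beta_s:A_{s^*}\to A_s$ and unitary multipliers $v_{s,t}$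 of $A_{st}$ such that, for all $r,s,t\in S$: $A_e=A$; $\beta_s\beta_t=\mathrm{Ad}\,v_{s,t}\circ\beta_{st}$ as partial maps; $v_{s,t}=1$ if $s$ or $t$ is idempotent; $\beta_r(av_{s,t})v_{r,st}=\beta_r(a)v_{r,s}v_{rs,t}$ for $a\in A_{r^*}A_{st}$. Two such actions $(A,S,\beta,v)$ and $(B,S,\nu,z)$ are *Morita equivalent*, via $(X,\phi)$, if $X$ is an $A$–$B$ imprimitivity bimodule with $X_s:=A_s\cdot X=X\cdot B_s$ for all $s$, and $\phi_s:X_{s^*}\to X_s$ are maps such that each $(\beta_s,\phi_s,\nu_s)$ is a partial automorphism of $X$ and $\phi_s\phi_t=v_{s,t}\cdot\phi_{st}(\cdot)\cdot z_{s,t}^*$, as partial maps, for all $s,t\in S$. Let $S(G)$ be Exel's inverse semigroup of $G$, whose elements have the canonical form $p=[g_1][g_1^{-1}]\cdots[g_m][g_m^{-1}][s]$ with $g_i,s\in G$. The Busby–Smith twisted action $(A,S(G),\beta,v)$ *corresponding* to $(A,G,\alpha,u)$ is $$A_p=A_{g_1}\cdots A_{g_m}A_s,\qquad \beta_p=\alpha_{g_1}\alpha_{g_1}^{-1}\cdots\alpha_{g_m}\alpha_{g_m}^{-1}\alpha_s,\qquad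 v_{p,q}=1_{M(A_{pq})}u_{s,t},$$ where $p=[g_1][g_1^{-1}]\cdots[g_m][g_m^{-1}][s]$ and $q=[h_1][h_1^{-1}]\cdots[h_n][h_n^{-1}][t]$. **Theorem.** Let $(A,G,\alpha,u)$ and $(B,G,\mu,w)$ be twisted partial actions of a group $G$ on $C^*$-algebras $A$ and $B$. They are Morita equivalent if and only if the corresponding Busby–Smith twisted actions $(A,S(G),\beta,v)$ and $(B,S(G),\nu,z)$ are Morita equivalent. Moreover, if $(X,\phi)$ is a Morita equivalence between $(A,G,\alpha,u)$ and $(B,G,\mu,w)$, then the partial maps $$\phi_p=\phi_{g_1}\phi_{g_1}^{-1}\cdots\phi_{g_m}\phi_{g_m}^{-1}\phi_s,\qquad p=[g_1][g_1^{-1}]\cdots[g_m][g_m^{-1}][s]\in S(G),$$ are well defined and give a Morita equivalence between $(A,S(G),\beta,v)$ and $(B,S(G),\nu,z)$ on the same bimodule $X$. -/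

import Mathlib

open scoped MultiplierAlgebra Pointwise Topology
open Filter

universe u v w

namespace MoritaActions

noncomputable section

/-! ### Closed ideals of C⋆-algebras and multipliers of ideals -/

/-- A closed two-sided ideal of a C⋆-algebra. (Such ideals are automatically complex subspaces
that are closed under the involution; this is recorded in the structure so that an ideal is
itself a C⋆-algebra.) -/
structure ClosedIdeal (A : Type u) [NonUnitalCStarAlgebra A] extends
    NonUnitalStarSubalgebra ℂ A where
  mul_mem_left' : ∀ (a : A) {x : A}, x ∈ carrier → a * x ∈ carrier
  mul_mem_right' : ∀ (a : A) {x : A}, x ∈ carrier → x * a ∈ carrier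
  isClosed' : IsClosed carrier

namespace ClosedIdeal

section
variable {A : Type u} [NonUnitalCStarAlgebra A]

instance : SetLike (ClosedIdeal A) A where
  coe I := I.carrier
  coe_injective I J h := by
    rcases I with ⟨I, _, _, _⟩
    rcases J with ⟨J, _, _, _⟩
    have : I = J := SetLike.coe_injective h
    subst this
    rfl

instance : PartialOrder (ClosedIdeal A) := .ofSetLike (ClosedIdeal A) A

instance : NonUnitalSubringClass (ClosedIdeal A) A where
  add_mem {I} _ _ ha hb := I.add_mem' ha hb
  zero_mem I := I.zero_mem'
  neg_mem {I} _ ha := neg_mem (S := NonUnitalStarSubalgebra ℂ A) (s := I.toNonUnitalStarSubalgebra) ha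
  mul_mem {I} _ _ ha hb := I.mul_mem' ha hb

instance : SMulMemClass (ClosedIdeal A) ℂ A where
  smul_mem {I} c _ ha := I.smul_mem' c ha

instance : StarMemClass (ClosedIdeal A) A where
  star_mem {I} _ ha := I.star_mem' ha

instance (I : ClosedIdeal A) : IsClosed (I : Set A) := I.isClosed'

theorem mul_mem_left (I : ClosedIdeal A) (a : A) {x : A} (hx : x ∈ I) : a * x ∈ I :=
  I.mul_mem_left' a hx

theorem mul_mem_right (I : ClosedIdeal A) (a : A) {x : A} (hx : x ∈ I) : x * a ∈ I :=
  I.mul_mem_right' a hx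

/-- The whole algebra. -/
instance : Top (ClosedIdeal A) where
  top :=
    { toNonUnitalStarSubalgebra := ⊤
      mul_mem_left' := fun _ _ _ => trivial
      mul_mem_right' := fun _ _ _ => trivial
      isClosed' := isClosed_univ }

/-- The intersection of a family of closed ideals. -/
def inter {ι : Type*} (f : ι → ClosedIdeal A) : ClosedIdeal A where
  carrier := {a | ∀ i, a ∈ f i}
  add_mem' ha hb i := add_mem (ha i) (hb i)
  zero_mem' i := zero_mem (f i)
  mul_mem' ha hb i := mul_mem (ha i) (hb i)
  smul_mem' c _ ha i := SMulMemClass.smul_mem c (ha i)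
  star_mem' ha i := star_mem (ha i)
  mul_mem_left' a _ hx i := (f i).mul_mem_left a (hx i)
  mul_mem_right' a _ hx i := (f i).mul_mem_right a (hx i)
  isClosed' := by
    simp only [Set.ofPred_forall]
    exact isClosed_iInter fun i => (f i).isClosed'

/-- The intersection of two closed ideals. In a C⋆-algebra it is equal to the product ideal
`I J`. -/
instance : Min (ClosedIdeal A) where
  min I J :=
    { carrier := {a | a ∈ I ∧ a ∈ J}
      add_mem' := fun ha hb => ⟨add_mem ha.1 hb.1, add_mem ha.2 hb.2⟩
      zero_mem' := ⟨zero_mem I, zero_mem J⟩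
      mul_mem' := fun ha hb => ⟨mul_mem ha.1 hb.1, mul_mem ha.2 hb.2⟩
      smul_mem' := fun c _ ha => ⟨SMulMemClass.smul_mem c ha.1, SMulMemClass.smul_mem c ha.2⟩
      star_mem' := fun ha => ⟨star_mem ha.1, star_mem ha.2⟩
      mul_mem_left' := fun a _ hx => ⟨I.mul_mem_left a hx.1, J.mul_mem_left a hx.2⟩
      mul_mem_right' := fun a _ hx => ⟨I.mul_mem_right a hx.1, J.mul_mem_right a hx.2⟩
      isClosed' := IsClosed.inter I.isClosed' J.isClosed' }

@[simp] theorem mem_top (a : A) : a ∈ (⊤ : ClosedIdeal A) := trivial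

@[simp] theorem mem_inter {ι : Type*} {f : ι → ClosedIdeal A} {a : A} :
    a ∈ inter f ↔ ∀ i, a ∈ f i := Iff.rfl

@[simp] theorem mem_min {I J : ClosedIdeal A} {a : A} : a ∈ I ⊓ J ↔ a ∈ I ∧ a ∈ J := Iff.rfl

theorem exists_approxUnit (A : Type u) [NonUnitalCStarAlgebra A] :
    ∃ l : Filter A, l.NeBot ∧ (∀ a, Tendsto (fun e => a * e) l (𝓝 a)) ∧
      (∀ a, Tendsto (fun e => e * a) l (𝓝 a)) ∧ ∀ᶠ e in l, ‖e‖ ≤ 1 := by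
  let _ := CStarAlgebra.spectralOrder A
  have := CStarAlgebra.spectralOrderedRing A
  have h := CStarAlgebra.increasingApproximateUnit A
  exact ⟨_, h.neBot, h.tendsto_mul_left, h.tendsto_mul_right, h.eventually_norm⟩

end

section multipliers
variable {A : Type u} [NonUnitalCStarAlgebra A]

theorem fst_mul (m : 𝓜(ℂ, A)) (a b : A) : m.fst (a * b) = m.fst a * b := by
  have h : ∀ c : A, c * (m.fst (a * b) - m.fst a * b) = 0 := fun c => by
    rw [mul_sub, ← mul_assoc c (m.fst a) b, ← m.central, ← m.central, mul_assoc, sub_self]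
  exact sub_eq_zero.1 (CStarRing.star_mul_self_eq_zero_iff _ |>.1 (h _))

theorem snd_mul (m : 𝓜(ℂ, A)) (a b : A) : m.snd (a * b) = a * m.snd b := by
  have h : ∀ c : A, (m.snd (a * b) - a * m.snd b) * c = 0 := fun c => by
    rw [sub_mul, mul_assoc a (m.snd b) c, m.central, m.central, mul_assoc, sub_self]
  exact sub_eq_zero.1 (CStarRing.mul_star_self_eq_zero_iff _ |>.1 (h _))

theorem fst_mem {I J : ClosedIdeal A} (m : 𝓜(ℂ, I)) {a : I} (ha : (a : A) ∈ J) :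
    (m.fst a : A) ∈ J := by
  obtain ⟨l, hl, he, -, -⟩ := exists_approxUnit ↥(I ⊓ J)
  have h1 : Tendsto (fun e : ↥(I ⊓ J) => a * (⟨e, e.2.1⟩ : I)) l (𝓝 a) := by
    rw [tendsto_subtype_rng]
    have h0 := (continuous_subtype_val.tendsto _).comp (he ⟨a, a.2, ha⟩)
    exact h0
  have h2 := (continuous_subtype_val.tendsto _).comp ((m.fst.continuous.tendsto a).comp h1)
  refine J.isClosed'.mem_of_tendsto h2 (Eventually.of_forall fun e => ?_)
  have : m.fst (a * (⟨e, e.2.1⟩ : I)) = m.fst a * (⟨e, e.2.1⟩ : I) := fst_mul m _ _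
  simp only [Function.comp_apply, this]
  exact J.mul_mem_left _ e.2.2

theorem snd_mem {I J : ClosedIdeal A} (m : 𝓜(ℂ, I)) {a : I} (ha : (a : A) ∈ J) :
    (m.snd a : A) ∈ J := by
  have h := fst_mem (J := J) (star m) (a := star a) (star_mem ha)
  rw [DoubleCentralizer.star_fst, star_star] at h
  simpa using star_mem h

/-- The restriction of a multiplier of `I` to an ideal `J` contained in `I`, that is,
the multiplier `1_{M(J)} m` of `J`. -/
def restrictMultiplier {I J : ClosedIdeal A} (h : J ≤ I) (m : 𝓜(ℂ, I)) : 𝓜(ℂ, J) where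
  fst :=
    { toFun := fun a => ⟨m.fst ⟨a, h a.2⟩, fst_mem m a.2⟩
      map_add' := fun a b => Subtype.ext (by
        have := congrArg Subtype.val (m.fst.map_add ⟨a, h a.2⟩ ⟨b, h b.2⟩)
        exact this)
      map_smul' := fun c a => Subtype.ext (by
        have := congrArg Subtype.val (m.fst.map_smul c ⟨a, h a.2⟩)
        exact this)
      cont := by
        refine Continuous.subtype_mk (continuous_subtype_val.comp (m.fst.continuous.comp ?_)) _
        exact Continuous.subtype_mk continuous_subtype_val _ }
  snd :=
    { toFun := fun a => ⟨m.snd ⟨a, h a.2⟩, snd_mem m a.2⟩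
      map_add' := fun a b => Subtype.ext (by
        have := congrArg Subtype.val (m.snd.map_add ⟨a, h a.2⟩ ⟨b, h b.2⟩)
        exact this)
      map_smul' := fun c a => Subtype.ext (by
        have := congrArg Subtype.val (m.snd.map_smul c ⟨a, h a.2⟩)
        exact this)
      cont := by
        refine Continuous.subtype_mk (continuous_subtype_val.comp (m.snd.continuous.comp ?_)) _
        exact Continuous.subtype_mk continuous_subtype_val _ }
  central := fun x y => Subtype.ext (by
    have := congrArg Subtype.val (m.central ⟨x, h x.2⟩ ⟨y, h y.2⟩)
    exact this)

theorem restrictMultiplier_one {I J : ClosedIdeal A} (h : J ≤ I) :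
    restrictMultiplier h (1 : 𝓜(ℂ, I)) = 1 := by
  ext x <;> rfl

/-- The restriction of a unitary multiplier of `I` to an ideal `J` contained in `I`. -/
def restrictUnitary {I J : ClosedIdeal A} (h : J ≤ I) (m : unitary 𝓜(ℂ, I)) :
    unitary 𝓜(ℂ, J) :=
  ⟨restrictMultiplier h m, by
    have h1 : star (restrictMultiplier h (m : 𝓜(ℂ, I))) * restrictMultiplier h m =
        restrictMultiplier h (star (m : 𝓜(ℂ, I)) * m) := by ext x <;> rfl
    have h2 : restrictMultiplier h (m : 𝓜(ℂ, I)) * star (restrictMultiplier h m) =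
        restrictMultiplier h ((m : 𝓜(ℂ, I)) * star m) := by ext x <;> rfl
    rw [Unitary.mem_iff, h1, h2, Unitary.coe_star_mul_self, Unitary.coe_mul_star_self,
      restrictMultiplier_one]
    exact ⟨rfl, rfl⟩⟩

theorem restrictUnitary_one {I J : ClosedIdeal A} (h : J ≤ I) :
    restrictUnitary h (1 : unitary 𝓜(ℂ, I)) = 1 :=
  Subtype.ext (restrictMultiplier_one h)

open Classical in
/-- The product `m a` of a multiplier `m` of the ideal `I` and an element `a` of `I`
(with the dummy value `0` if `a` is not in `I`). -/
def mulLeft {I : ClosedIdeal A} (m : 𝓜(ℂ, I)) (a : A) : A :=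
  if h : a ∈ I then m.fst ⟨a, h⟩ else 0

open Classical in
/-- The product `a m` of an element `a` of the ideal `I` and a multiplier `m` of `I`
(with the dummy value `0` if `a` is not in `I`). -/
def mulRight {I : ClosedIdeal A} (a : A) (m : 𝓜(ℂ, I)) : A :=
  if h : a ∈ I then m.snd ⟨a, h⟩ else 0

theorem mulLeft_of_mem {I : ClosedIdeal A} (m : 𝓜(ℂ, I)) {a : A} (h : a ∈ I) :
    mulLeft m a = m.fst ⟨a, h⟩ := dif_pos h

theorem mulRight_of_mem {I : ClosedIdeal A} (m : 𝓜(ℂ, I)) {a : A} (h : a ∈ I) :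
    mulRight a m = m.snd ⟨a, h⟩ := dif_pos h

theorem mulRight_mem {I J : ClosedIdeal A} (m : 𝓜(ℂ, I)) {a : A} (h : a ∈ J) :
    mulRight a m ∈ J := by
  by_cases hI : a ∈ I
  · rw [mulRight_of_mem m hI]
    exact snd_mem m h
  · rw [mulRight, dif_neg hI]
    exact zero_mem J

theorem mulLeft_restrict {I J : ClosedIdeal A} (h : J ≤ I) (m : unitary 𝓜(ℂ, I)) {a : A}
    (ha : a ∈ J) : mulLeft (restrictUnitary h m : 𝓜(ℂ, J)) a = mulLeft (m : 𝓜(ℂ, I)) a := by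
  rw [mulLeft_of_mem _ ha, mulLeft_of_mem _ (h ha)]
  rfl

theorem mulRight_restrict {I J : ClosedIdeal A} (h : J ≤ I) (m : unitary 𝓜(ℂ, I)) {a : A}
    (ha : a ∈ J) : mulRight a (restrictUnitary h m : 𝓜(ℂ, J)) = mulRight a (m : 𝓜(ℂ, I)) := by
  rw [mulRight_of_mem _ ha, mulRight_of_mem _ (h ha)]
  rfl

theorem mulRight_star_restrict {I J : ClosedIdeal A} (h : J ≤ I) (m : unitary 𝓜(ℂ, I)) {a : A}
    (ha : a ∈ J) : mulRight a (star (restrictUnitary h m : 𝓜(ℂ, J))) =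
      mulRight a (star (m : 𝓜(ℂ, I))) := by
  rw [mulRight_of_mem _ ha, mulRight_of_mem _ (h ha)]
  rfl

open Classical in
/-- An isomorphism `f : I → J` between closed ideals as a function on elements of `A`
(with the dummy value `0` outside `I`). -/
def apply {I J : ClosedIdeal A} (f : I ≃⋆ₐ[ℂ] J) (a : A) : A :=
  if h : a ∈ I then f ⟨a, h⟩ else 0

theorem apply_of_mem {I J : ClosedIdeal A} (f : I ≃⋆ₐ[ℂ] J) {a : A} (h : a ∈ I) :
    apply f a = f ⟨a, h⟩ := dif_pos h

end multipliers
end ClosedIdeal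

open ClosedIdeal

/-! ### Twisted partial actions of groups -/

/-- A (discrete) twisted partial action `(α, u)` of the group `G` on the C⋆-algebra `A`. -/
structure TwistedPartialAction (G : Type w) [Group G] (A : Type u) [NonUnitalCStarAlgebra A] where
  /-- the closed ideals `A_s` -/
  ideal : G → ClosedIdeal A
  /-- the partial automorphisms `α_s : A_{s⁻¹} → A_s` -/
  act : ∀ s, ideal s⁻¹ ≃⋆ₐ[ℂ] ideal s
  /-- the unitary multipliers `u_{r,s}` of `A_r A_{rs}` -/
  twist : ∀ r s, unitary 𝓜(ℂ, ↥(ideal r ⊓ ideal (r * s)))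
  ideal_one : ideal 1 = ⊤
  act_one : ∀ a : A, apply (act 1) a = a
  image_act : ∀ r s, apply (act r) '' (↑(ideal r⁻¹ ⊓ ideal s) : Set A) = ↑(ideal r ⊓ ideal (r * s))
  act_act : ∀ r s, ∀ a ∈ ideal s⁻¹ ⊓ ideal (s⁻¹ * r⁻¹),
    apply (act r) (apply (act s) a) =
      mulLeft (twist r s : 𝓜(ℂ, ↥(ideal r ⊓ ideal (r * s))))
        (mulRight (apply (act (r * s)) a) (star (twist r s : 𝓜(ℂ, ↥(ideal r ⊓ ideal (r * s))))))
  twist_one_left : ∀ t, twist 1 t = 1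
  twist_one_right : ∀ t, twist t 1 = 1
  cocycle : ∀ r s t, ∀ a ∈ ideal r⁻¹ ⊓ (ideal s ⊓ ideal (s * t)),
    mulRight (apply (act r) (mulRight a (twist s t : 𝓜(ℂ, ↥(ideal s ⊓ ideal (s * t))))))
        (twist r (s * t) : 𝓜(ℂ, ↥(ideal r ⊓ ideal (r * (s * t))))) =
      mulRight (mulRight (apply (act r) a) (twist r s : 𝓜(ℂ, ↥(ideal r ⊓ ideal (r * s)))))
        (twist (r * s) t : 𝓜(ℂ, ↥(ideal (r * s) ⊓ ideal (r * s * t))))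

/-! ### Unital inverse semigroups and their Busby–Smith twisted actions -/

/-- A unital inverse semigroup: every `s` has exactly one generalized inverse `star s`. -/
class InverseMonoid (S : Type w) extends Monoid S, Star S where
  mul_star_mul : ∀ s : S, s * star s * s = s
  star_mul_star : ∀ s : S, star s * s * star s = star s
  star_unique : ∀ s t : S, s * t * s = s → t * s * t = t → t = star s

/-- A Busby–Smith twisted action `(β, v)` of the unital inverse semigroup `S` on `A`. -/
structure BusbySmithAction (S : Type w) [InverseMonoid S] (A : Type u)
    [NonUnitalCStarAlgebra A] where
  /-- the closed ideals `A_s` -/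
  ideal : S → ClosedIdeal A
  /-- the partial automorphisms `β_s : A_{s*} → A_s` -/
  act : ∀ s, ideal (star s) ≃⋆ₐ[ℂ] ideal s
  /-- the unitary multipliers `v_{s,t}` of `A_{st}` -/
  twist : ∀ s t, unitary 𝓜(ℂ, ideal (s * t))
  ideal_one : ideal 1 = ⊤
  /-- `β_s β_t` and `Ad v_{s,t} ∘ β_{st}` have the same domain -/
  act_act_dom : ∀ s t, ∀ a : A, a ∈ ideal (star (s * t)) ↔
    a ∈ ideal (star t) ∧ apply (act t) a ∈ ideal (star s)
  act_act : ∀ s t, ∀ a ∈ ideal (star (s * t)),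
    apply (act s) (apply (act t) a) =
      mulLeft (twist s t : 𝓜(ℂ, ideal (s * t)))
        (mulRight (apply (act (s * t)) a) (star (twist s t : 𝓜(ℂ, ideal (s * t)))))
  twist_idem : ∀ s t, IsIdempotentElem s ∨ IsIdempotentElem t → twist s t = 1
  cocycle : ∀ r s t, ∀ a ∈ ideal (star r) ⊓ ideal (s * t),
    mulRight (apply (act r) (mulRight a (twist s t : 𝓜(ℂ, ideal (s * t)))))
        (twist r (s * t) : 𝓜(ℂ, ideal (r * (s * t)))) =
      mulRight (mulRight (apply (act r) a) (twist r s : 𝓜(ℂ, ideal (r * s))))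
        (twist (r * s) t : 𝓜(ℂ, ideal (r * s * t)))

/-! ### Exel's inverse semigroup of a group -/

/-- The inverse semigroup `S(G)` of a group `G`. The element with canonical form
`[g₁][g₁⁻¹]⋯[gₘ][gₘ⁻¹][s]` is the pair of the finite set `{1, s, g₁, …, gₘ}` and `s`: the order
and repetitions of the factors `[gᵢ][gᵢ⁻¹]` are irrelevant, and the factors `[1][1⁻¹]` and
`[s][s⁻¹]` can be added or omitted without changing the element. -/
@[ext]
structure ExelSemigroup (G : Type w) [Group G] where
  supp : Set G
  elt : G
  finite : supp.Finite
  one_mem : 1 ∈ supp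
  elt_mem : elt ∈ supp

namespace ExelSemigroup
variable {G : Type w} [Group G]

/-- The generator `[s]`. -/
def bracket (s : G) : ExelSemigroup G where
  supp := {1, s}
  elt := s
  finite := by simp
  one_mem := by simp
  elt_mem := by simp

instance : Mul (ExelSemigroup G) where
  mul p q :=
    { supp := p.supp ∪ p.elt • q.supp
      elt := p.elt * q.elt
      finite := p.finite.union q.finite.smul_set
      one_mem := Or.inl p.one_mem
      elt_mem := Or.inr (Set.smul_mem_smul_set q.elt_mem) }

instance : One (ExelSemigroup G) where
  one :=
    { supp := {1}
      elt := 1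
      finite := by simp
      one_mem := rfl
      elt_mem := rfl }

instance : Star (ExelSemigroup G) where
  star p :=
    { supp := p.elt⁻¹ • p.supp
      elt := p.elt⁻¹
      finite := p.finite.smul_set
      one_mem := ⟨p.elt, p.elt_mem, by simp⟩
      elt_mem := ⟨1, p.one_mem, by simp⟩ }

@[simp] theorem supp_mul (p q : ExelSemigroup G) : (p * q).supp = p.supp ∪ p.elt • q.supp := rfl
@[simp] theorem elt_mul (p q : ExelSemigroup G) : (p * q).elt = p.elt * q.elt := rfl
@[simp] theorem supp_one : (1 : ExelSemigroup G).supp = {1} := rfl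
@[simp] theorem elt_one : (1 : ExelSemigroup G).elt = 1 := rfl
@[simp] theorem supp_star (p : ExelSemigroup G) : (star p).supp = p.elt⁻¹ • p.supp := rfl
@[simp] theorem elt_star (p : ExelSemigroup G) : (star p).elt = p.elt⁻¹ := rfl

instance : InverseMonoid (ExelSemigroup G) where
  mul_assoc p q r := by
    ext1
    · simp [Set.smul_set_union, smul_smul, Set.union_assoc]
    · simp [mul_assoc]
  one_mul p := by
    ext1
    · simpa using p.one_mem
    · simp
  mul_one p := by
    ext1
    · simpa using p.elt_mem
    · simp
  mul_star_mul p := by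
    ext1 <;> simp
  star_mul_star p := by
    ext1 <;> simp
  star_unique p q h1 h2 := by
    have e := congrArg elt h1
    have s1 := congrArg supp h1
    have s2 := congrArg supp h2
    have hq : q.elt = p.elt⁻¹ := by
      simp only [elt_mul] at e
      rw [mul_assoc, mul_eq_left, mul_eq_one_iff_eq_inv] at e
      exact e
    ext1
    · simp only [supp_mul, elt_mul, hq, mul_inv_cancel, inv_mul_cancel, one_smul] at s1 s2
      apply Set.Subset.antisymm
      · rw [supp_star, Set.subset_smul_set_iff, inv_inv]
        exact (Set.subset_union_right.trans Set.subset_union_left).trans s1.subset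
      · exact (Set.subset_union_right.trans Set.subset_union_left).trans s2.subset
    · exact hq

theorem elt_eq_one_of_idem {p : ExelSemigroup G} (h : IsIdempotentElem p) : p.elt = 1 := by
  have := congrArg elt h
  simpa using this

/-- The element `[g₁][g₁⁻¹]⋯[gₘ][gₘ⁻¹][s]`. -/
def word (l : List G) (s : G) : ExelSemigroup G :=
  (l.map fun g => bracket g * bracket g⁻¹).prod * bracket s

end ExelSemigroup

/-! ### The Busby–Smith twisted action of `S(G)` corresponding to a twisted partial action -/

namespace TwistedPartialAction

variable {G : Type w} [Group G] {A : Type u} [NonUnitalCStarAlgebra A]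
  (α : TwistedPartialAction G A)

theorem act_mem_iff (s h : G) (a : α.ideal s⁻¹) :
    (α.act s a : A) ∈ α.ideal h ↔ (a : A) ∈ α.ideal (s⁻¹ * h) := by
  have key := α.image_act s (s⁻¹ * h)
  rw [mul_inv_cancel_left] at key
  constructor
  · intro hm
    have : (α.act s a : A) ∈ apply (α.act s) '' (↑(α.ideal s⁻¹ ⊓ α.ideal (s⁻¹ * h)) : Set A) := by
      rw [key]
      exact ⟨(α.act s a).2, hm⟩
    obtain ⟨b, hb, hab⟩ := this
    rw [apply_of_mem _ hb.1] at hab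
    have := (α.act s).injective (Subtype.ext hab)
    rw [← this]
    exact hb.2
  · intro hm
    have : apply (α.act s) a ∈ (↑(α.ideal s ⊓ α.ideal h) : Set A) := by
      rw [← key]
      exact ⟨a, ⟨a.2, hm⟩, rfl⟩
    rw [apply_of_mem _ a.2] at this
    exact this.2

/-- The ideal `A_p = A_{g₁} ⋯ A_{gₘ} A_s` for `p = [g₁][g₁⁻¹]⋯[gₘ][gₘ⁻¹][s]`; a product of
closed ideals is their intersection. -/
def semigroupIdeal (p : ExelSemigroup G) : ClosedIdeal A := inter fun g : p.supp => α.ideal g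

theorem mem_semigroupIdeal {p : ExelSemigroup G} {a : A} :
    a ∈ α.semigroupIdeal p ↔ ∀ g ∈ p.supp, a ∈ α.ideal g := by
  simp [semigroupIdeal]

theorem semigroupIdeal_le (p : ExelSemigroup G) : α.semigroupIdeal p ≤ α.ideal p.elt :=
  fun _ ha => α.mem_semigroupIdeal.1 ha _ p.elt_mem

theorem semigroupIdeal_star_le (p : ExelSemigroup G) :
    α.semigroupIdeal (star p) ≤ α.ideal p.elt⁻¹ := α.semigroupIdeal_le (star p)

theorem semigroupIdeal_mul_le (p q : ExelSemigroup G) :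
    α.semigroupIdeal (p * q) ≤ α.ideal p.elt ⊓ α.ideal (p.elt * q.elt) :=
  fun _ ha => ⟨α.mem_semigroupIdeal.1 ha _ (Or.inl p.elt_mem), α.semigroupIdeal_le (p * q) ha⟩

theorem act_mem_semigroupIdeal_iff (p : ExelSemigroup G) (s : G) (a : α.ideal s⁻¹) :
    (α.act s a : A) ∈ α.semigroupIdeal p ↔ ∀ g ∈ p.supp, (a : A) ∈ α.ideal (s⁻¹ * g) := by
  simp [mem_semigroupIdeal, act_mem_iff]

theorem mem_semigroupIdeal_star {p : ExelSemigroup G} {a : A} :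
    a ∈ α.semigroupIdeal (star p) ↔ ∀ g ∈ p.supp, a ∈ α.ideal (p.elt⁻¹ * g) := by
  simp [mem_semigroupIdeal, Set.mem_smul_set]

/-- The partial automorphism `β_p = α_{g₁} α_{g₁}⁻¹ ⋯ α_{gₘ} α_{gₘ}⁻¹ α_s : A_{p*} → A_p`.
As `α_g α_g⁻¹` is the identity map of `A_g`, it is the restriction of `α_s`. -/
def semigroupAct (p : ExelSemigroup G) :
    α.semigroupIdeal (star p) ≃⋆ₐ[ℂ] α.semigroupIdeal p where
  toFun a := ⟨α.act p.elt ⟨a, α.semigroupIdeal_star_le p a.2⟩,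
    (α.act_mem_semigroupIdeal_iff p p.elt _).2 (α.mem_semigroupIdeal_star.1 a.2)⟩
  invFun b := ⟨(α.act p.elt).symm ⟨b, α.semigroupIdeal_le p b.2⟩,
    α.mem_semigroupIdeal_star.2 ((α.act_mem_semigroupIdeal_iff p p.elt _).1 (by
      rw [StarAlgEquiv.apply_symm_apply]
      exact b.2))⟩
  left_inv a := Subtype.ext (by simp)
  right_inv b := Subtype.ext (by simp)
  map_mul' a b := Subtype.ext (by
    have h := congrArg Subtype.val (map_mul (α.act p.elt)
      ⟨a, α.semigroupIdeal_star_le p a.2⟩ ⟨b, α.semigroupIdeal_star_le p b.2⟩)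
    exact h)
  map_add' a b := Subtype.ext (by
    have h := congrArg Subtype.val (map_add (α.act p.elt)
      ⟨a, α.semigroupIdeal_star_le p a.2⟩ ⟨b, α.semigroupIdeal_star_le p b.2⟩)
    exact h)
  map_star' a := Subtype.ext (by
    have h := congrArg Subtype.val (map_star (α.act p.elt) ⟨a, α.semigroupIdeal_star_le p a.2⟩)
    exact h)
  map_smul' c a := Subtype.ext (by
    have h := congrArg Subtype.val (map_smul (α.act p.elt) c
      ⟨a, α.semigroupIdeal_star_le p a.2⟩)
    exact h)

theorem apply_semigroupAct (p : ExelSemigroup G) {a : A} (ha : a ∈ α.semigroupIdeal (star p)) :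
    apply (α.semigroupAct p) a = apply (α.act p.elt) a := by
  rw [apply_of_mem _ ha, apply_of_mem _ (α.semigroupIdeal_star_le p ha)]
  rfl

theorem apply_semigroupAct_mem (p : ExelSemigroup G) {a : A}
    (ha : a ∈ α.semigroupIdeal (star p)) : apply (α.semigroupAct p) a ∈ α.semigroupIdeal p := by
  rw [apply_of_mem _ ha]
  exact Subtype.property _

/-- The unitary multiplier `v_{p,q} = 1_{M(A_{pq})} u_{s,t}`. -/
def semigroupTwist (p q : ExelSemigroup G) : unitary 𝓜(ℂ, α.semigroupIdeal (p * q)) :=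
  restrictUnitary (α.semigroupIdeal_mul_le p q) (α.twist p.elt q.elt)

theorem semigroup_act_dom (p q : ExelSemigroup G) (a : A) :
    a ∈ α.semigroupIdeal (star (p * q)) ↔
      a ∈ α.semigroupIdeal (star q) ∧ apply (α.semigroupAct q) a ∈ α.semigroupIdeal (star p) := by
  have h : a ∈ α.semigroupIdeal (star (p * q)) ↔ a ∈ α.semigroupIdeal (star q) ∧
      ∀ g ∈ p.supp, a ∈ α.ideal (q.elt⁻¹ * (p.elt⁻¹ * g)) := by
    simp only [mem_semigroupIdeal_star, ExelSemigroup.supp_mul, ExelSemigroup.elt_mul, Set.mem_union,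
      Set.mem_smul_set, smul_eq_mul, mul_inv_rev, or_imp, forall_and, mul_assoc,
      forall_exists_index, and_imp, forall_apply_eq_imp_iff₂, inv_mul_cancel_left]
    exact and_comm
  rw [h]
  refine and_congr_right fun ha => ?_
  rw [apply_semigroupAct _ _ ha, apply_of_mem _ (α.semigroupIdeal_star_le q ha),
    act_mem_semigroupIdeal_iff]
  simp [Set.mem_smul_set]

theorem mem_mul_of_mem (p q : ExelSemigroup G) {a : A} (ha : a ∈ α.semigroupIdeal (star p))
    (haq : a ∈ α.semigroupIdeal q) : apply (α.semigroupAct p) a ∈ α.semigroupIdeal (p * q) := by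
  rw [mem_semigroupIdeal, ExelSemigroup.supp_mul]
  rintro g (hg | ⟨g, hg, rfl⟩)
  · exact α.mem_semigroupIdeal.1 (α.apply_semigroupAct_mem p ha) g hg
  · rw [apply_semigroupAct _ _ ha, apply_of_mem _ (α.semigroupIdeal_star_le p ha), act_mem_iff]
    simpa using α.mem_semigroupIdeal.1 haq g hg

/-- The Busby–Smith twisted action of `S(G)` corresponding to a twisted partial action of `G`. -/
def toBusbySmith : BusbySmithAction (ExelSemigroup G) A where
  ideal := α.semigroupIdeal
  act := α.semigroupAct
  twist := α.semigroupTwist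
  ideal_one := by
    refine SetLike.ext fun a => ?_
    simp [mem_semigroupIdeal, α.ideal_one]
  act_act_dom := α.semigroup_act_dom
  act_act p q a ha := by
    have h := (α.semigroup_act_dom p q a).1 ha
    have h1 := α.semigroupIdeal_star_le q h.1
    have h2 : a ∈ α.ideal (q.elt⁻¹ * p.elt⁻¹) := by
      simpa using α.semigroupIdeal_star_le (p * q) ha
    rw [apply_semigroupAct _ _ h.2, apply_semigroupAct _ _ h.1, α.act_act _ _ _ ⟨h1, h2⟩]
    have h3 := α.apply_semigroupAct_mem _ ha
    rw [semigroupTwist, mulRight_star_restrict _ _ h3, mulLeft_restrict _ _ (mulRight_mem _ h3),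
      apply_semigroupAct _ _ ha]
    rfl
  twist_idem p q h := by
    have h1 : α.twist p.elt q.elt = 1 := by
      rcases h with h | h
      · rw [ExelSemigroup.elt_eq_one_of_idem h]
        exact α.twist_one_left _
      · rw [ExelSemigroup.elt_eq_one_of_idem h]
        exact α.twist_one_right _
    rw [semigroupTwist, h1]
    exact restrictUnitary_one _
  cocycle p q r a ha := by
    have hq := α.semigroupIdeal_mul_le q r ha.2
    have h1 : mulRight a (α.semigroupTwist q r : 𝓜(ℂ, α.semigroupIdeal (q * r))) =
        mulRight a (α.twist q.elt r.elt : 𝓜(ℂ, ↥(α.ideal q.elt ⊓ α.ideal (q.elt * r.elt)))) :=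
      mulRight_restrict _ _ ha.2
    have h2 := mulRight_mem (J := α.semigroupIdeal (star p))
      (α.semigroupTwist q r : 𝓜(ℂ, α.semigroupIdeal (q * r))) ha.1
    have h3 := mulRight_mem (J := α.semigroupIdeal (q * r))
      (α.semigroupTwist q r : 𝓜(ℂ, α.semigroupIdeal (q * r))) ha.2
    have h4 := α.mem_mul_of_mem p (q * r) h2 h3
    have h5 := α.mem_mul_of_mem p (q * r) ha.1 ha.2
    have h6 : apply (α.semigroupAct p) a ∈ α.semigroupIdeal (p * q) := by
      refine α.mem_semigroupIdeal.2 fun g hg => α.mem_semigroupIdeal.1 h5 g ?_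
      rcases hg with hg | hg
      · exact Or.inl hg
      · exact Or.inr (Set.smul_set_mono Set.subset_union_left hg)
    have h7 : apply (α.semigroupAct p) a ∈ α.semigroupIdeal (p * q * r) := by
      rw [mul_assoc]
      exact h5
    have key := α.cocycle p.elt q.elt r.elt a ⟨α.semigroupIdeal_star_le p ha.1, hq⟩
    rw [← h1, ← apply_semigroupAct _ _ h2, ← apply_semigroupAct _ _ ha.1] at key
    have e1 : mulRight (apply (α.semigroupAct p)
          (mulRight a (α.semigroupTwist q r : 𝓜(ℂ, α.semigroupIdeal (q * r)))))
        (α.semigroupTwist p (q * r) : 𝓜(ℂ, α.semigroupIdeal (p * (q * r)))) = _ :=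
      mulRight_restrict _ _ h4
    have e2 : mulRight (apply (α.semigroupAct p) a)
        (α.semigroupTwist p q : 𝓜(ℂ, α.semigroupIdeal (p * q))) = _ :=
      mulRight_restrict _ _ h6
    have e3 := mulRight_mem (J := α.semigroupIdeal (p * q * r))
      (α.twist p.elt q.elt : 𝓜(ℂ, ↥(α.ideal p.elt ⊓ α.ideal (p.elt * q.elt)))) h7
    have e4 : mulRight (mulRight (apply (α.semigroupAct p) a)
          (α.twist p.elt q.elt : 𝓜(ℂ, ↥(α.ideal p.elt ⊓ α.ideal (p.elt * q.elt)))))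
        (α.semigroupTwist (p * q) r : 𝓜(ℂ, α.semigroupIdeal (p * q * r))) = _ :=
      mulRight_restrict _ _ e3
    rw [e1, e2, e4]
    exact key

end TwistedPartialAction

/-! ### Imprimitivity bimodules -/

/-- An `A`-`B` imprimitivity bimodule: a bimodule that is a full left Hilbert `A`-module and a
full right Hilbert `B`-module, with compatible inner products. The norm of the complex vector
space `X` is the one defined by either inner product (the two norms of a Hilbert bimodule
agree). Positivity `0 ≤ c` in a C⋆-algebra is expressed as `c = d* d`. -/
structure ImprimitivityBimodule (A : Type u) [NonUnitalCStarAlgebra A]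
    (B : Type v) [NonUnitalCStarAlgebra B] where
  carrier : Type w
  [normedAddCommGroup : NormedAddCommGroup carrier]
  [normedSpace : NormedSpace ℂ carrier]
  [completeSpace : CompleteSpace carrier]
  /-- the left module structure `a · x` -/
  lsmul : A →ₗ[ℂ] carrier →ₗ[ℂ] carrier
  /-- the right module structure `x · b` -/
  rsmul : carrier →ₗ[ℂ] B →ₗ[ℂ] carrier
  mul_lsmul : ∀ a a' x, lsmul (a * a') x = lsmul a (lsmul a' x)
  rsmul_mul : ∀ x b b', rsmul x (b * b') = rsmul (rsmul x b) b'
  lsmul_rsmul : ∀ a x b, lsmul a (rsmul x b) = rsmul (lsmul a x) b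
  /-- the `A`-valued inner product -/
  linner : carrier → carrier → A
  linner_add : ∀ x y z, linner (x + y) z = linner x z + linner y z
  linner_smul : ∀ (c : ℂ) x y, linner (c • x) y = c • linner x y
  linner_lsmul : ∀ a x y, linner (lsmul a x) y = a * linner x y
  star_linner : ∀ x y, star (linner x y) = linner y x
  linner_nonneg : ∀ x, ∃ a, linner x x = star a * a
  norm_sq_eq_linner : ∀ x, ‖x‖ ^ 2 = ‖linner x x‖
  /-- the `B`-valued inner product -/
  rinner : carrier → carrier → B
  rinner_add : ∀ x y z, rinner x (y + z) = rinner x y + rinner x z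
  rinner_smul : ∀ (c : ℂ) x y, rinner x (c • y) = c • rinner x y
  rinner_rsmul : ∀ x y b, rinner x (rsmul y b) = rinner x y * b
  star_rinner : ∀ x y, star (rinner x y) = rinner y x
  rinner_nonneg : ∀ x, ∃ b, rinner x x = star b * b
  norm_sq_eq_rinner : ∀ x, ‖x‖ ^ 2 = ‖rinner x x‖
  linner_lsmul_eq : ∀ x y z, lsmul (linner x y) z = rsmul x (rinner y z)
  left_full : (Submodule.span ℂ {a | ∃ x y, a = linner x y}).topologicalClosure = ⊤
  right_full : (Submodule.span ℂ {b | ∃ x y, b = rinner x y}).topologicalClosure = ⊤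

theorem exists_tendsto_of_mem_closure {X : Type*} [NormedAddCommGroup X] [NormedSpace ℂ X]
    [CompleteSpace X] {ι : Type*} (l : Filter ι) [l.NeBot] (T : ι → X →ₗ[ℂ] X) (C : ℝ)
    (hC : ∀ᶠ i in l, ∀ x, ‖T i x‖ ≤ C * ‖x‖) (S : Set X)
    (hS : ∀ x ∈ S, ∃ y, Tendsto (fun i => T i x) l (𝓝 y)) {x : X}
    (hx : x ∈ (Submodule.span ℂ S).topologicalClosure) :
    ∃ y, Tendsto (fun i => T i x) l (𝓝 y) := by
  have hspan : ∀ x ∈ Submodule.span ℂ S, ∃ y, Tendsto (fun i => T i x) l (𝓝 y) := by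
    intro x hx
    induction hx using Submodule.span_induction with
    | mem x h => exact hS x h
    | zero => exact ⟨0, by simp⟩
    | add x y _ _ hx hy =>
      obtain ⟨x', hx⟩ := hx
      obtain ⟨y', hy⟩ := hy
      exact ⟨x' + y', by simpa using hx.add hy⟩
    | smul c x _ hx =>
      obtain ⟨x', hx⟩ := hx
      exact ⟨c • x', by simpa using hx.const_smul c⟩
  rw [← cauchy_map_iff_exists_tendsto, Metric.cauchy_iff]
  refine ⟨inferInstance, fun ε hε => ?_⟩
  obtain ⟨z, hz, hxz⟩ := Metric.mem_closure_iff.1 hx (ε / 4 / (|C| + 1)) (by positivity)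
  obtain ⟨y, hy⟩ := hspan z hz
  refine ⟨Metric.ball y (ε / 2), ?_, fun a ha b hb => ?_⟩
  · rw [mem_map]
    filter_upwards [hC, Metric.tendsto_nhds.1 hy (ε / 4) (by positivity)] with i hi hi'
    have h1 : dist (T i x) (T i z) < ε / 4 := by
      rw [dist_eq_norm, ← map_sub]
      rw [dist_eq_norm, lt_div_iff₀ (by positivity)] at hxz
      have h2 := hi (x - z)
      have h3 : C * ‖x - z‖ ≤ |C| * ‖x - z‖ :=
        mul_le_mul_of_nonneg_right (le_abs_self C) (norm_nonneg _)
      nlinarith [norm_nonneg (x - z)]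
    rw [Set.mem_preimage, Metric.mem_ball]
    linarith [dist_triangle (T i x) (T i z) y]
  · rw [Metric.mem_ball] at ha hb
    linarith [dist_triangle_right a b y]

theorem eq_zero_of_mem_closure {X : Type*} [NormedAddCommGroup X] [NormedSpace ℂ X]
    {ι : Type*} (l : Filter ι) [l.NeBot] (T : ι → X →ₗ[ℂ] X)
    (hC : ∀ᶠ i in l, ∀ x, ‖T i x‖ ≤ ‖x‖) (S : Set X)
    (hS : ∀ x ∈ S, Tendsto (fun i => T i x) l (𝓝 x)) {x : X}
    (hx : x ∈ (Submodule.span ℂ S).topologicalClosure) (h0 : ∀ i, T i x = 0) : x = 0 := by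
  have hspan : ∀ x ∈ Submodule.span ℂ S, Tendsto (fun i => T i x) l (𝓝 x) := by
    intro x hx
    induction hx using Submodule.span_induction with
    | mem x h => exact hS x h
    | zero => simp
    | add x y _ _ hx hy => simpa using hx.add hy
    | smul c x _ hx => simpa using hx.const_smul c
  rw [← norm_le_zero_iff]
  refine le_of_forall_pos_le_add fun ε hε => ?_
  obtain ⟨z, hz, hxz⟩ := Metric.mem_closure_iff.1 hx (ε / 2) (by positivity)
  have h1 : ‖z‖ ≤ ε / 2 := by
    refine le_of_tendsto (hspan z hz).norm ?_
    filter_upwards [hC] with i hi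
    have h2 := hi (z - x)
    rw [map_sub, h0, sub_zero] at h2
    rw [dist_comm, dist_eq_norm] at hxz
    exact h2.trans hxz.le
  rw [dist_eq_norm] at hxz
  have h3 : ‖x‖ ≤ ‖x - z‖ + ‖z‖ := by simpa using norm_add_le (x - z) z
  linarith

namespace ImprimitivityBimodule

attribute [instance] normedAddCommGroup normedSpace completeSpace

variable {A : Type u} [NonUnitalCStarAlgebra A] {B : Type v} [NonUnitalCStarAlgebra B]
  (X : ImprimitivityBimodule.{u, v, w} A B)

instance : CoeSort (ImprimitivityBimodule.{u, v, w} A B) (Type w) := ⟨carrier⟩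

/-- The closed subspace `I · X`, for a closed ideal `I` of `A`. -/
def leftSub (I : ClosedIdeal A) : Submodule ℂ X :=
  (Submodule.span ℂ {z : X | ∃ a ∈ I, ∃ x : X, z = X.lsmul a x}).topologicalClosure

/-- The closed subspace `X · J`, for a closed ideal `J` of `B`. -/
def rightSub (J : ClosedIdeal B) : Submodule ℂ X :=
  (Submodule.span ℂ {z : X | ∃ x : X, ∃ b ∈ J, z = X.rsmul x b}).topologicalClosure

theorem norm_lsmul_le (a : A) (x : X) : ‖X.lsmul a x‖ ≤ ‖a‖ * ‖x‖ := by
  have h : ‖X.lsmul a x‖ ^ 2 ≤ (‖a‖ * ‖x‖) ^ 2 := by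
    have e : X.linner (X.lsmul a x) (X.lsmul a x) = a * X.linner x x * star a := by
      rw [X.linner_lsmul, ← X.star_linner (X.lsmul a x) x, X.linner_lsmul, star_mul,
        X.star_linner, mul_assoc]
    rw [X.norm_sq_eq_linner, e, mul_pow, X.norm_sq_eq_linner x]
    calc ‖a * X.linner x x * star a‖ ≤ ‖a‖ * ‖X.linner x x‖ * ‖star a‖ :=
          (norm_mul_le _ _).trans (mul_le_mul_of_nonneg_right (norm_mul_le _ _) (norm_nonneg _))
      _ = ‖a‖ ^ 2 * ‖X.linner x x‖ := by rw [norm_star]; ring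
  exact le_of_sq_le_sq h (by positivity)

theorem norm_rsmul_le (x : X) (b : B) : ‖X.rsmul x b‖ ≤ ‖x‖ * ‖b‖ := by
  have h : ‖X.rsmul x b‖ ^ 2 ≤ (‖x‖ * ‖b‖) ^ 2 := by
    have e : X.rinner (X.rsmul x b) (X.rsmul x b) = star b * X.rinner x x * b := by
      rw [X.rinner_rsmul, ← X.star_rinner x (X.rsmul x b), X.rinner_rsmul, star_mul,
        X.star_rinner]
    rw [X.norm_sq_eq_rinner, e, mul_pow, X.norm_sq_eq_rinner x]
    calc ‖star b * X.rinner x x * b‖ ≤ ‖star b‖ * ‖X.rinner x x‖ * ‖b‖ :=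
          (norm_mul_le _ _).trans (mul_le_mul_of_nonneg_right (norm_mul_le _ _) (norm_nonneg _))
      _ = ‖X.rinner x x‖ * ‖b‖ ^ 2 := by rw [norm_star]; ring
  exact le_of_sq_le_sq h (by positivity)

theorem tendsto_lsmul {ι : Type*} {l : Filter ι} {a : ι → A} {a₀ : A} (h : Tendsto a l (𝓝 a₀))
    (x : X) : Tendsto (fun i => X.lsmul (a i) x) l (𝓝 (X.lsmul a₀ x)) := by
  have hc : Continuous (X.lsmul.flip x) :=
    ((X.lsmul.flip x).mkContinuous ‖x‖ fun a => by
      simpa [mul_comm] using X.norm_lsmul_le a x).continuous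
  exact (hc.tendsto a₀).comp h

theorem tendsto_rsmul {ι : Type*} {l : Filter ι} {b : ι → B} {b₀ : B} (h : Tendsto b l (𝓝 b₀))
    (x : X) : Tendsto (fun i => X.rsmul x (b i)) l (𝓝 (X.rsmul x b₀)) := by
  have hc : Continuous (X.rsmul x) :=
    ((X.rsmul x).mkContinuous ‖x‖ fun b => X.norm_rsmul_le x b).continuous
  exact (hc.tendsto b₀).comp h

theorem continuous_lsmul (a : A) : Continuous (X.lsmul a) :=
  ((X.lsmul a).mkContinuous ‖a‖ fun x => X.norm_lsmul_le a x).continuous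

theorem continuous_rsmul (b : B) : Continuous fun x => X.rsmul x b :=
  ((X.rsmul.flip b).mkContinuous ‖b‖ fun x => by
      simpa [mul_comm] using X.norm_rsmul_le x b).continuous

theorem lsmul_mem_leftSub {I : ClosedIdeal A} {a : A} (ha : a ∈ I) (x : X) :
    X.lsmul a x ∈ X.leftSub I :=
  Submodule.le_topologicalClosure _ (Submodule.subset_span ⟨a, ha, x, rfl⟩)

theorem rsmul_mem_rightSub {J : ClosedIdeal B} (x : X) {b : B} (hb : b ∈ J) :
    X.rsmul x b ∈ X.rightSub J :=
  Submodule.le_topologicalClosure _ (Submodule.subset_span ⟨x, b, hb, rfl⟩)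

theorem eq_of_lsmul_eq {I : ClosedIdeal A} {y z : X} (hy : y ∈ X.leftSub I)
    (hz : z ∈ X.leftSub I) (h : ∀ a ∈ I, X.lsmul a y = X.lsmul a z) : y = z := by
  obtain ⟨l, hl, -, he, hn⟩ := exists_approxUnit ↥I
  refine sub_eq_zero.1 (eq_zero_of_mem_closure l (fun e : I => X.lsmul e) (by
    filter_upwards [hn] with e he x
    exact (X.norm_lsmul_le _ _).trans (mul_le_of_le_one_left (norm_nonneg _) he)) _ (by
    rintro _ ⟨a, ha, x, rfl⟩
    refine (X.tendsto_lsmul ((continuous_subtype_val.tendsto _).comp (he ⟨a, ha⟩)) x).congr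
      fun e => X.mul_lsmul _ _ _) (sub_mem hy hz) fun e => ?_)
  rw [map_sub, h e e.2, sub_self]

theorem eq_of_rsmul_eq {J : ClosedIdeal B} {y z : X} (hy : y ∈ X.rightSub J)
    (hz : z ∈ X.rightSub J) (h : ∀ b ∈ J, X.rsmul y b = X.rsmul z b) : y = z := by
  obtain ⟨l, hl, he, -, hn⟩ := exists_approxUnit ↥J
  refine sub_eq_zero.1 (eq_zero_of_mem_closure l (fun e : J => X.rsmul.flip e) (by
    filter_upwards [hn] with e he x
    exact (X.norm_rsmul_le _ _).trans (mul_le_of_le_one_right (norm_nonneg _) he)) _ (by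
    rintro _ ⟨x, b, hb, rfl⟩
    refine (X.tendsto_rsmul ((continuous_subtype_val.tendsto _).comp (he ⟨b, hb⟩)) x).congr
      fun e => X.rsmul_mul _ _ _) (sub_mem hy hz) fun e => ?_)
  rw [map_sub, LinearMap.flip_apply, LinearMap.flip_apply, h e e.2, sub_self]

theorem exists_lmul {I : ClosedIdeal A} (m : 𝓜(ℂ, I)) {x : X} (hx : x ∈ X.leftSub I) :
    ∃ y ∈ X.leftSub I, ∀ a ∈ I, X.lsmul a y = X.lsmul (mulRight a m) x := by
  obtain ⟨l, hl, he1, he2, hn⟩ := exists_approxUnit ↥I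
  have key := exists_tendsto_of_mem_closure l (fun e : I => X.lsmul (m.fst e)) ‖m.fst‖ (by
    filter_upwards [hn] with e he x
    refine (X.norm_lsmul_le _ _).trans (mul_le_mul_of_nonneg_right ?_ (norm_nonneg _))
    exact (m.fst.le_opNorm e).trans (mul_le_of_le_one_right (norm_nonneg _) he)) _ (by
    rintro _ ⟨a, ha, x, rfl⟩
    refine ⟨X.lsmul (m.fst ⟨a, ha⟩) x, ?_⟩
    have h1 := (m.fst.continuous.tendsto _).comp (he2 ⟨a, ha⟩)
    have h2 := X.tendsto_lsmul ((continuous_subtype_val.tendsto _).comp h1) x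
    refine h2.congr fun e => ?_
    have h3 : m.fst (e * ⟨a, ha⟩) = m.fst e * ⟨a, ha⟩ := fst_mul m _ _
    simp only [Function.comp_apply, h3]
    exact X.mul_lsmul _ _ _) hx
  obtain ⟨y, hy⟩ := key
  refine ⟨y, ?_, fun a ha => ?_⟩
  · exact (Submodule.isClosed_topologicalClosure _).mem_of_tendsto hy
      (Eventually.of_forall fun e => X.lsmul_mem_leftSub (m.fst e).2 x)
  · refine tendsto_nhds_unique (((X.continuous_lsmul a).tendsto y).comp hy) ?_
    rw [mulRight_of_mem m ha]
    have h1 := (continuous_subtype_val.tendsto _).comp (he1 (m.snd ⟨a, ha⟩))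
    refine (X.tendsto_lsmul h1 x).congr fun e => ?_
    have h2 := congrArg Subtype.val (m.central ⟨a, ha⟩ e)
    simp only [Function.comp_apply, ← X.mul_lsmul]
    rw [h2]
    rfl

theorem exists_rmul {J : ClosedIdeal B} (m : 𝓜(ℂ, J)) {x : X} (hx : x ∈ X.rightSub J) :
    ∃ y ∈ X.rightSub J, ∀ b ∈ J, X.rsmul y b = X.rsmul x (mulLeft m b) := by
  obtain ⟨l, hl, he1, he2, hn⟩ := exists_approxUnit ↥J
  have key := exists_tendsto_of_mem_closure l (fun e : J => X.rsmul.flip (m.snd e)) ‖m.snd‖ (by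
    filter_upwards [hn] with e he x
    rw [LinearMap.flip_apply, mul_comm]
    refine (X.norm_rsmul_le _ _).trans (mul_le_mul_of_nonneg_left ?_ (norm_nonneg _))
    exact (m.snd.le_opNorm e).trans (mul_le_of_le_one_right (norm_nonneg _) he)) _ (by
    rintro _ ⟨x, b, hb, rfl⟩
    refine ⟨X.rsmul x (m.snd ⟨b, hb⟩), ?_⟩
    have h1 := (m.snd.continuous.tendsto _).comp (he1 ⟨b, hb⟩)
    have h2 := X.tendsto_rsmul ((continuous_subtype_val.tendsto _).comp h1) x
    refine h2.congr fun e => ?_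
    have h3 : m.snd (⟨b, hb⟩ * e) = ⟨b, hb⟩ * m.snd e := snd_mul m _ _
    simp only [Function.comp_apply, h3]
    exact X.rsmul_mul _ _ _) hx
  obtain ⟨y, hy⟩ := key
  refine ⟨y, ?_, fun b hb => ?_⟩
  · exact (Submodule.isClosed_topologicalClosure _).mem_of_tendsto hy
      (Eventually.of_forall fun e => X.rsmul_mem_rightSub x (m.snd e).2)
  · refine tendsto_nhds_unique (((X.continuous_rsmul b).tendsto y).comp hy) ?_
    rw [mulLeft_of_mem m hb]
    have h1 := (continuous_subtype_val.tendsto _).comp (he2 (m.fst ⟨b, hb⟩))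
    refine (X.tendsto_rsmul h1 x).congr fun e => ?_
    have h2 := congrArg Subtype.val (m.central e ⟨b, hb⟩)
    simp only [Function.comp_apply, LinearMap.flip_apply, ← X.rsmul_mul]
    rw [show ((m.snd e : B) * b) = (e : B) * (m.fst ⟨b, hb⟩ : B) from h2]
    rfl

open Classical in
/-- The action `m · x` of a multiplier `m` of the closed ideal `I` of `A` on an element `x` of
`I · X`: the element `y` of `I · X` with `a · y = (a m) · x` for all `a ∈ I`
(with the dummy value `0` if `x` is not in `I · X`). -/
def lmul {I : ClosedIdeal A} (m : 𝓜(ℂ, I)) (x : X) : X :=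
  if h : x ∈ X.leftSub I then (X.exists_lmul m h).choose else 0

open Classical in
/-- The action `x · m` of a multiplier `m` of the closed ideal `J` of `B` on an element `x` of
`X · J`: the element `y` of `X · J` with `y · b = x · (m b)` for all `b ∈ J`
(with the dummy value `0` if `x` is not in `X · J`). -/
def rmul {J : ClosedIdeal B} (x : X) (m : 𝓜(ℂ, J)) : X :=
  if h : x ∈ X.rightSub J then (X.exists_rmul m h).choose else 0

theorem lmul_spec {I : ClosedIdeal A} (m : 𝓜(ℂ, I)) {x : X} (hx : x ∈ X.leftSub I) :
    X.lmul m x ∈ X.leftSub I ∧ ∀ a ∈ I, X.lsmul a (X.lmul m x) = X.lsmul (mulRight a m) x := by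
  rw [lmul, dif_pos hx]
  exact (X.exists_lmul m hx).choose_spec

theorem rmul_spec {J : ClosedIdeal B} (m : 𝓜(ℂ, J)) {x : X} (hx : x ∈ X.rightSub J) :
    X.rmul x m ∈ X.rightSub J ∧ ∀ b ∈ J, X.rsmul (X.rmul x m) b = X.rsmul x (mulLeft m b) := by
  rw [rmul, dif_pos hx]
  exact (X.exists_rmul m hx).choose_spec

/-- `m · (a · x) = (m a) · x`. -/
theorem lmul_lsmul {I : ClosedIdeal A} (m : 𝓜(ℂ, I)) {a : A} (ha : a ∈ I) (x : X) :
    X.lmul m (X.lsmul a x) = X.lsmul (mulLeft m a) x := by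
  have h := X.lmul_spec m (X.lsmul_mem_leftSub ha x)
  rw [mulLeft_of_mem m ha]
  refine X.eq_of_lsmul_eq h.1 (X.lsmul_mem_leftSub (Subtype.property _) x) fun c hc => ?_
  rw [h.2 c hc, mulRight_of_mem m hc, ← X.mul_lsmul, ← X.mul_lsmul]
  exact congrArg (fun t : I => X.lsmul (t : A) x) (m.central ⟨c, hc⟩ ⟨a, ha⟩)

/-- `(x · b) · m = x · (b m)`. -/
theorem rmul_rsmul {J : ClosedIdeal B} (m : 𝓜(ℂ, J)) (x : X) {b : B} (hb : b ∈ J) :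
    X.rmul (X.rsmul x b) m = X.rsmul x (mulRight b m) := by
  have h := X.rmul_spec m (X.rsmul_mem_rightSub x hb)
  rw [mulRight_of_mem m hb]
  refine X.eq_of_rsmul_eq h.1 (X.rsmul_mem_rightSub x (Subtype.property _)) fun c hc => ?_
  rw [h.2 c hc, mulLeft_of_mem m hc, ← X.rsmul_mul, ← X.rsmul_mul]
  exact congrArg (fun t : J => X.rsmul x (t : B)) (m.central ⟨b, hb⟩ ⟨c, hc⟩).symm

/-- `Y` is a closed subbimodule of `X` and `_I Y_J` is an imprimitivity subbimodule: `I` and `J`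
are the closed spans of the inner products of elements of `Y`. -/
structure IsImprimitivitySubbimodule (I : ClosedIdeal A) (Y : Submodule ℂ X)
    (J : ClosedIdeal B) : Prop where
  isClosed : IsClosed (Y : Set X)
  lsmul_mem : ∀ (a : A), ∀ y ∈ Y, X.lsmul a y ∈ Y
  rsmul_mem : ∀ y ∈ Y, ∀ b : B, X.rsmul y b ∈ Y
  left_span : ((Submodule.span ℂ {a | ∃ y ∈ Y, ∃ z ∈ Y, a = X.linner y z}).topologicalClosure :
    Set A) = I
  right_span : ((Submodule.span ℂ {b | ∃ y ∈ Y, ∃ z ∈ Y, b = X.rinner y z}).topologicalClosure :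
    Set B) = J

/-- The triple `(α, φ, β)` is a partial automorphism of `X`: an isomorphism from the
imprimitivity subbimodule `_I Y_J` onto the imprimitivity subbimodule `_{I'} Y'_{J'}`. The
map `φ` is a bijection of `Y` onto `Y'`, that is, a partial bijection of `X` with source `Y` and
target `Y'`. -/
structure IsPartialAutomorphism {I I' : ClosedIdeal A} {J J' : ClosedIdeal B}
    (Y Y' : Submodule ℂ X) (α : I ≃⋆ₐ[ℂ] I') (φ : PartialEquiv X X) (β : J ≃⋆ₐ[ℂ] J') :
    Prop where
  source_sub : X.IsImprimitivitySubbimodule I Y J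
  target_sub : X.IsImprimitivitySubbimodule I' Y' J'
  source_eq : φ.source = Y
  target_eq : φ.target = Y'
  map_rsmul : ∀ x ∈ Y, ∀ b ∈ J, φ (X.rsmul x b) = X.rsmul (φ x) (apply β b)
  map_rinner : ∀ x ∈ Y, ∀ y ∈ Y, apply β (X.rinner x y) = X.rinner (φ x) (φ y)
  map_lsmul : ∀ a ∈ I, ∀ x ∈ Y, φ (X.lsmul a x) = X.lsmul (apply α a) (φ x)
  map_linner : ∀ x ∈ Y, ∀ y ∈ Y, apply α (X.linner x y) = X.linner (φ x) (φ y)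

end ImprimitivityBimodule

/-! ### Morita equivalence -/

section
variable {A : Type u} [NonUnitalCStarAlgebra A] {B : Type v} [NonUnitalCStarAlgebra B]

/-- `(X, φ)` is a Morita equivalence between the twisted partial actions `(α, u)` and `(μ, w)`.
Here `X_s = A_s · X = X · B_s`. -/
structure TwistedPartialAction.IsMoritaEquivalence {G : Type*} [Group G]
    (α : TwistedPartialAction G A) (μ : TwistedPartialAction G B)
    (X : ImprimitivityBimodule.{u, v, w} A B) (φ : G → PartialEquiv X X) : Prop where
  sub_eq : ∀ s, X.leftSub (α.ideal s) = X.rightSub (μ.ideal s)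
  partialAut : ∀ s, X.IsPartialAutomorphism (X.leftSub (α.ideal s⁻¹)) (X.leftSub (α.ideal s))
    (α.act s) (φ s) (μ.act s)
  comp : ∀ s t, ∀ x ∈ X.rightSub (μ.ideal (t⁻¹ * s⁻¹) ⊓ μ.ideal t⁻¹),
    φ s (φ t x) =
      X.rmul (X.lmul (α.twist s t : 𝓜(ℂ, ↥(α.ideal s ⊓ α.ideal (s * t)))) (φ (s * t) x))
        (star (μ.twist s t : 𝓜(ℂ, ↥(μ.ideal s ⊓ μ.ideal (s * t)))))

/-- The twisted partial actions `(A, G, α, u)` and `(B, G, μ, w)` are Morita equivalent. -/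
def TwistedPartialAction.MoritaEquivalent {G : Type*} [Group G]
    (α : TwistedPartialAction G A) (μ : TwistedPartialAction G B) : Prop :=
  ∃ (X : ImprimitivityBimodule.{u, v, max u v} A B) (φ : G → PartialEquiv X X),
    α.IsMoritaEquivalence μ X φ

/-- `(X, φ)` is a Morita equivalence between the Busby–Smith twisted actions `(α, u)` and
`(β, v)`. Here `X_s = A_s · X = X · B_s`; the equality
`φ_s φ_t = u_{s,t} · φ_{st}(·) · v_{s,t}*` of partial maps is an equality of domains
(`comp_source`) and of values (`comp`). -/
structure BusbySmithAction.IsMoritaEquivalence {S : Type*} [InverseMonoid S]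
    (α : BusbySmithAction S A) (β : BusbySmithAction S B)
    (X : ImprimitivityBimodule.{u, v, w} A B) (φ : S → PartialEquiv X X) : Prop where
  sub_eq : ∀ s, X.leftSub (α.ideal s) = X.rightSub (β.ideal s)
  partialAut : ∀ s, X.IsPartialAutomorphism (X.leftSub (α.ideal (star s)))
    (X.leftSub (α.ideal s)) (α.act s) (φ s) (β.act s)
  comp_source : ∀ s t, ((φ t).trans (φ s)).source = (φ (s * t)).source
  comp : ∀ s t, ∀ x ∈ (φ (s * t)).source,
    φ s (φ t x) =
      X.rmul (X.lmul (α.twist s t : 𝓜(ℂ, α.ideal (s * t))) (φ (s * t) x))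
        (star (β.twist s t : 𝓜(ℂ, β.ideal (s * t))))

/-- The Busby–Smith twisted actions `(A, S, α, u)` and `(B, S, β, v)` are Morita equivalent. -/
def BusbySmithAction.MoritaEquivalent {S : Type*} [InverseMonoid S]
    (α : BusbySmithAction S A) (β : BusbySmithAction S B) : Prop :=
  ∃ (X : ImprimitivityBimodule.{u, v, max u v} A B) (φ : S → PartialEquiv X X),
    α.IsMoritaEquivalence β X φ

/-- The composition `φ_{g₁} φ_{g₁}⁻¹ ⋯ φ_{gₘ} φ_{gₘ}⁻¹ φ_s` of partial bijections. -/
def wordComp {G X : Type*} (φ : G → PartialEquiv X X) (l : List G) (s : G) : PartialEquiv X X :=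
  l.foldr (fun g ψ => ψ.trans ((φ g).symm.trans (φ g))) (φ s)

end

end
end MoritaActions

/-!
Everything rests on one observation about an imprimitivity bimodule `X`: membership of `x` in
`I · X` (or in `X · J`) is equivalent to `⟨x, x⟩ ∈ I` (or `⟨x, x⟩ ∈ J`); see `mem_leftSub_iff`
and `mem_rightSub_iff`. Hence `I ↦ I · X` turns intersections of ideals into intersections of
subspaces, and a partial automorphism `(α, φ, β)` satisfies `φ x ∈ K · X ↔ α ⟨x, x⟩ ∈ K`, so that
domains of compositions of the maps `φ` can be read off from the ideals of the action.

Given a Morita equivalence `(X, φ)` of twisted partial actions, the map attached to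
`p = [g₁][g₁⁻¹]⋯[gₘ][gₘ⁻¹][s]` is the restriction of `φ_s` to `A_{p*} · X` (`semigroupMap`).
It is a partial automorphism by `IsPartialAutomorphism.restr`, the composition law is inherited
from `φ` because multipliers act on smaller subspaces through their restrictions
(`lmul_restrict`, `rmul_restrict`), and it agrees with the composition of partial bijections given
by the word because `φ_g φ_g⁻¹` is the identity of `A_g · X` (`semigroupMap_word`).

Conversely, a Morita equivalence `(X, ψ)` of the actions of `S(G)` gives `φ_s = ψ_{[s]}`. The
twists are trivial on idempotents, so `ψ_e` is an identity map for `e` idempotent; as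
`[s][t] = [s][s⁻¹][st]`, the map `ψ_{[s][t]}` is a restriction of `ψ_{[st]}`, and the composition
law for `ψ` becomes that for `φ` (`of_toBusbySmith`).
-/

namespace MoritaActions

open ClosedIdeal

namespace ImprimitivityBimodule

variable {A : Type u} [NonUnitalCStarAlgebra A] {B : Type v} [NonUnitalCStarAlgebra B]
  (X : ImprimitivityBimodule.{u, v, w} A B)

/-! ### Inner products -/

theorem linner_sub_left (x y z : X) : X.linner (x - y) z = X.linner x z - X.linner y z := by
  rw [eq_sub_iff_add_eq, ← X.linner_add, sub_add_cancel]

theorem linner_sub_right (x y z : X) : X.linner x (y - z) = X.linner x y - X.linner x z := by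
  rw [← X.star_linner, linner_sub_left, star_sub, X.star_linner, X.star_linner]

theorem linner_lsmul_right (a : A) (x y : X) :
    X.linner x (X.lsmul a y) = X.linner x y * star a := by
  rw [← X.star_linner, X.linner_lsmul, star_mul, X.star_linner]

theorem rinner_sub_right (x y z : X) : X.rinner x (y - z) = X.rinner x y - X.rinner x z := by
  rw [eq_sub_iff_add_eq, ← X.rinner_add, sub_add_cancel]

theorem rinner_sub_left (x y z : X) : X.rinner (x - y) z = X.rinner x z - X.rinner y z := by
  rw [← X.star_rinner, rinner_sub_right, star_sub, X.star_rinner, X.star_rinner]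

theorem rinner_rsmul_left (b : B) (x y : X) :
    X.rinner (X.rsmul x b) y = star b * X.rinner x y := by
  rw [← X.star_rinner, X.rinner_rsmul, star_mul, X.star_rinner]

/-! ### The subspaces `I · X` and `X · J` -/

theorem linner_mem_of_mem_span {I : ClosedIdeal A} {z : X}
    (hz : z ∈ Submodule.span ℂ {z : X | ∃ a ∈ I, ∃ x : X, z = X.lsmul a x}) (y : X) :
    X.linner z y ∈ I := by
  induction hz using Submodule.span_induction with
  | mem z h =>
    obtain ⟨a, ha, x, rfl⟩ := h
    rw [X.linner_lsmul]
    exact I.mul_mem_right _ ha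
  | zero =>
    rw [← sub_self y, linner_sub_left, sub_self]
    exact zero_mem I
  | add x z _ _ hx hz =>
    rw [X.linner_add]
    exact add_mem hx hz
  | smul c x _ hx =>
    rw [X.linner_smul]
    exact SMulMemClass.smul_mem c hx

theorem rinner_mem_of_mem_span {J : ClosedIdeal B} {z : X}
    (hz : z ∈ Submodule.span ℂ {z : X | ∃ x : X, ∃ b ∈ J, z = X.rsmul x b}) (y : X) :
    X.rinner y z ∈ J := by
  induction hz using Submodule.span_induction with
  | mem z h =>
    obtain ⟨x, b, hb, rfl⟩ := h
    rw [X.rinner_rsmul]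
    exact J.mul_mem_left _ hb
  | zero =>
    rw [← sub_self y, rinner_sub_right, sub_self]
    exact zero_mem J
  | add x z _ _ hx hz =>
    rw [X.rinner_add]
    exact add_mem hx hz
  | smul c x _ hx =>
    rw [X.rinner_smul]
    exact SMulMemClass.smul_mem c hx

/-- Membership in `I · X` is detected by the inner square. For the converse, an approximate unit
`e` of `I` satisfies `e · x → x`, because `⟨x - e x, x - e x⟩ = w - e w` with
`w = ⟨x, x⟩ - ⟨x, x⟩ e* → 0`. -/
theorem mem_leftSub_iff {I : ClosedIdeal A} {x : X} :
    x ∈ X.leftSub I ↔ X.linner x x ∈ I := by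
  constructor
  · intro hx
    refine I.isClosed'.closure_subset (Metric.mem_closure_iff.2 fun ε hε => ?_)
    obtain ⟨z, hz, hxz⟩ := Metric.mem_closure_iff.1 hx (√ε) (Real.sqrt_pos.2 hε)
    have hz' := X.linner_mem_of_mem_span hz
    refine ⟨X.linner z x + X.linner (x - z) z, add_mem (hz' x) ?_, ?_⟩
    · rw [← X.star_linner]
      exact star_mem (hz' _)
    · have e : X.linner x x - (X.linner z x + X.linner (x - z) z) = X.linner (x - z) (x - z) := by
        rw [linner_sub_right X (x - z), linner_sub_left X x z x]
        abel
      rw [dist_eq_norm, e, ← X.norm_sq_eq_linner, ← dist_eq_norm]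
      exact (Real.lt_sqrt dist_nonneg).1 hxz
  · intro hx
    obtain ⟨l, hl, -, he, hn⟩ := exists_approxUnit ↥I
    have hc : Tendsto (fun e : I => (e : A) * X.linner x x) l (𝓝 (X.linner x x)) :=
      (continuous_subtype_val.tendsto _).comp (he ⟨_, hx⟩)
    have hw : Tendsto (fun e : I => ‖X.linner x x - X.linner x x * star (e : A)‖) l (𝓝 0) := by
      have h := (tendsto_const_nhds (x := X.linner x x)).sub ((continuous_star.tendsto _).comp hc)
      simpa [X.star_linner] using h.norm
    have hsq : Tendsto (fun e : I => ‖x - X.lsmul e x‖ ^ 2) l (𝓝 0) := by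
      refine squeeze_zero' (Eventually.of_forall fun _ => sq_nonneg _) ?_
        (by simpa using hw.const_mul 2)
      filter_upwards [hn] with e hen
      have hen' : ‖(e : A)‖ ≤ 1 := hen
      rw [X.norm_sq_eq_linner, linner_sub_left, X.linner_lsmul, linner_sub_right,
        linner_lsmul_right]
      refine (norm_sub_le _ _).trans ?_
      have := (norm_mul_le (e : A) (X.linner x x - X.linner x x * star (e : A))).trans
        (mul_le_of_le_one_left (norm_nonneg _) hen')
      linarith
    have hlim : Tendsto (fun e : I => X.lsmul e x) l (𝓝 x) := by
      rw [tendsto_iff_norm_sub_tendsto_zero]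
      have := (Real.continuous_sqrt.tendsto 0).comp hsq
      simpa [Function.comp_def, Real.sqrt_sq (norm_nonneg _), norm_sub_rev] using this
    exact (Submodule.isClosed_topologicalClosure _).mem_of_tendsto hlim
      (Eventually.of_forall fun e => X.lsmul_mem_leftSub e.2 x)

theorem mem_rightSub_iff {J : ClosedIdeal B} {x : X} :
    x ∈ X.rightSub J ↔ X.rinner x x ∈ J := by
  constructor
  · intro hx
    refine J.isClosed'.closure_subset (Metric.mem_closure_iff.2 fun ε hε => ?_)
    obtain ⟨z, hz, hxz⟩ := Metric.mem_closure_iff.1 hx (√ε) (Real.sqrt_pos.2 hε)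
    have hz' := X.rinner_mem_of_mem_span hz
    refine ⟨X.rinner x z + X.rinner z (x - z), add_mem (hz' x) ?_, ?_⟩
    · rw [← X.star_rinner]
      exact star_mem (hz' _)
    · have e : X.rinner x x - (X.rinner x z + X.rinner z (x - z)) = X.rinner (x - z) (x - z) := by
        rw [rinner_sub_left X x z (x - z), rinner_sub_right X x x z]
        abel
      rw [dist_eq_norm, e, ← X.norm_sq_eq_rinner, ← dist_eq_norm]
      exact (Real.lt_sqrt dist_nonneg).1 hxz
  · intro hx
    obtain ⟨l, hl, he, -, hn⟩ := exists_approxUnit ↥J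
    have hc : Tendsto (fun e : J => X.rinner x x * (e : B)) l (𝓝 (X.rinner x x)) :=
      (continuous_subtype_val.tendsto _).comp (he ⟨_, hx⟩)
    have hw : Tendsto (fun e : J => ‖X.rinner x x - star (e : B) * X.rinner x x‖) l (𝓝 0) := by
      have h := (tendsto_const_nhds (x := X.rinner x x)).sub ((continuous_star.tendsto _).comp hc)
      simpa [X.star_rinner] using h.norm
    have hsq : Tendsto (fun e : J => ‖x - X.rsmul x e‖ ^ 2) l (𝓝 0) := by
      refine squeeze_zero' (Eventually.of_forall fun _ => sq_nonneg _) ?_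
        (by simpa using hw.const_mul 2)
      filter_upwards [hn] with e hen
      have hen' : ‖(e : B)‖ ≤ 1 := hen
      rw [X.norm_sq_eq_rinner, rinner_sub_right, X.rinner_rsmul, rinner_sub_left,
        rinner_rsmul_left]
      refine (norm_sub_le _ _).trans ?_
      have := (norm_mul_le (X.rinner x x - star (e : B) * X.rinner x x) (e : B)).trans
        (mul_le_of_le_one_right (norm_nonneg _) hen')
      linarith
    have hlim : Tendsto (fun e : J => X.rsmul x e) l (𝓝 x) := by
      rw [tendsto_iff_norm_sub_tendsto_zero]
      have := (Real.continuous_sqrt.tendsto 0).comp hsq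
      simpa [Function.comp_def, Real.sqrt_sq (norm_nonneg _), norm_sub_rev] using this
    exact (Submodule.isClosed_topologicalClosure _).mem_of_tendsto hlim
      (Eventually.of_forall fun e => X.rsmul_mem_rightSub x e.2)

theorem leftSub_mono {I I' : ClosedIdeal A} (h : I ≤ I') : X.leftSub I ≤ X.leftSub I' :=
  fun _ hx => X.mem_leftSub_iff.2 (h (X.mem_leftSub_iff.1 hx))

theorem rightSub_mono {J J' : ClosedIdeal B} (h : J ≤ J') : X.rightSub J ≤ X.rightSub J' :=
  fun _ hx => X.mem_rightSub_iff.2 (h (X.mem_rightSub_iff.1 hx))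

theorem lsmul_mem_leftSub_of_mem {I : ClosedIdeal A} (a : A) {x : X} (hx : x ∈ X.leftSub I) :
    X.lsmul a x ∈ X.leftSub I := by
  rw [mem_leftSub_iff, X.linner_lsmul, linner_lsmul_right]
  exact I.mul_mem_left _ (I.mul_mem_right _ (X.mem_leftSub_iff.1 hx))

theorem rsmul_mem_rightSub_of_mem {J : ClosedIdeal B} {x : X} (hx : x ∈ X.rightSub J) (b : B) :
    X.rsmul x b ∈ X.rightSub J := by
  rw [mem_rightSub_iff, X.rinner_rsmul, rinner_rsmul_left]
  exact J.mul_mem_right _ (J.mul_mem_left _ (X.mem_rightSub_iff.1 hx))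

theorem leftSub_inter_eq_rightSub_inter {ι : Type*} {f : ι → ClosedIdeal A}
    {g : ι → ClosedIdeal B} (h : ∀ i, X.leftSub (f i) = X.rightSub (g i)) :
    X.leftSub (inter f) = X.rightSub (inter g) := by
  ext x
  rw [mem_leftSub_iff, mem_rightSub_iff, mem_inter, mem_inter]
  refine forall_congr' fun i => ?_
  rw [← mem_leftSub_iff, ← mem_rightSub_iff, h]

/-- Polarization: `2 ⟨y, z⟩ = p + i q` with `p = ⟨y, z⟩ + ⟨z, y⟩` and
`q = ⟨y, i z⟩ + ⟨i z, y⟩`, and `p`, `q` are combinations of inner squares. -/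
theorem linner_mem {I : ClosedIdeal A} {y z : X} (hy : y ∈ X.leftSub I)
    (hz : z ∈ X.leftSub I) : X.linner y z ∈ I := by
  have add_right : ∀ a b c, X.linner a (b + c) = X.linner a b + X.linner a c := fun a b c => by
    rw [← X.star_linner, X.linner_add, star_add, X.star_linner, X.star_linner]
  have hp : ∀ z ∈ X.leftSub I, X.linner y z + X.linner z y ∈ I := fun z hz => by
    have h := sub_mem (sub_mem (X.mem_leftSub_iff.1 (add_mem hy hz)) (X.mem_leftSub_iff.1 hy))
      (X.mem_leftSub_iff.1 hz)
    rw [X.linner_add, add_right, add_right] at h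
    convert h using 1
    abel
  have hq := hp _ (Submodule.smul_mem _ Complex.I hz)
  rw [X.linner_smul, ← X.star_linner (Complex.I • z) y, X.linner_smul, star_smul,
    X.star_linner] at hq
  have h2 : (2⁻¹ : ℂ) • ((X.linner y z + X.linner z y) +
      Complex.I • (star Complex.I • X.linner y z + Complex.I • X.linner z y)) ∈ I :=
    SMulMemClass.smul_mem _ (add_mem (hp z hz) (SMulMemClass.smul_mem _ hq))
  convert h2 using 1
  simp only [smul_add, smul_smul, Complex.star_def, Complex.conj_I, mul_neg, Complex.I_mul_I]
  module

theorem rinner_mem {J : ClosedIdeal B} {y z : X} (hy : y ∈ X.rightSub J)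
    (hz : z ∈ X.rightSub J) : X.rinner y z ∈ J := by
  have add_left : ∀ a b c, X.rinner (a + b) c = X.rinner a c + X.rinner b c := fun a b c => by
    rw [← X.star_rinner, X.rinner_add, star_add, X.star_rinner, X.star_rinner]
  have hp : ∀ z ∈ X.rightSub J, X.rinner y z + X.rinner z y ∈ J := fun z hz => by
    have h := sub_mem (sub_mem (X.mem_rightSub_iff.1 (add_mem hy hz)) (X.mem_rightSub_iff.1 hy))
      (X.mem_rightSub_iff.1 hz)
    rw [X.rinner_add, add_left, add_left] at h
    convert h using 1
    abel
  have hq := hp _ (Submodule.smul_mem _ Complex.I hz)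
  rw [X.rinner_smul, ← X.star_rinner y (Complex.I • z), X.rinner_smul, star_smul,
    X.star_rinner] at hq
  have h2 : (2⁻¹ : ℂ) • ((X.rinner y z + X.rinner z y) -
      Complex.I • (Complex.I • X.rinner y z + star Complex.I • X.rinner z y)) ∈ J :=
    SMulMemClass.smul_mem _ (sub_mem (hp z hz) (SMulMemClass.smul_mem _ hq))
  convert h2 using 1
  simp only [smul_add, smul_smul, Complex.star_def, Complex.conj_I, mul_neg, Complex.I_mul_I]
  module

/-- Every ideal `I` is the closed span of the inner products of elements of `I · X`: for
`e, e' ∈ I` one has `e ⟨x, y⟩ e'* = ⟨e x, e' y⟩`, so fullness of `X` puts all of `I A I` into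
the closed span, and an approximate unit gives `I`. -/
theorem closure_span_linner_leftSub (I : ClosedIdeal A) :
    ((Submodule.span ℂ {a | ∃ y ∈ X.leftSub I, ∃ z ∈ X.leftSub I,
      a = X.linner y z}).topologicalClosure : Set A) = I := by
  set K := (Submodule.span ℂ {a | ∃ y ∈ X.leftSub I, ∃ z ∈ X.leftSub I,
    a = X.linner y z}).topologicalClosure with hK
  have hKc : IsClosed (K : Set A) := Submodule.isClosed_topologicalClosure _
  apply Set.Subset.antisymm
  · refine closure_minimal (fun a ha => ?_) I.isClosed'
    induction ha using Submodule.span_induction with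
    | mem a h =>
      obtain ⟨y, hy, z, hz, rfl⟩ := h
      exact X.linner_mem hy hz
    | zero => exact zero_mem I
    | add x z _ _ hx hz => exact add_mem hx hz
    | smul c x _ hx => exact SMulMemClass.smul_mem c hx
  · intro a ha
    have key : ∀ e ∈ I, ∀ e' ∈ I, e * a * e' ∈ K := by
      intro e he e' he'
      have hfull : a ∈ (Submodule.span ℂ {a | ∃ x y, a = X.linner x y}).topologicalClosure := by
        rw [X.left_full]
        trivial
      have hcont : Continuous fun a : A => e * a * e' := by fun_prop
      refine hKc.closure_subset (map_mem_closure (f := fun a => e * a * e') hcont hfull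
        (t := (K : Set A)) fun c hc => ?_)
      change e * c * e' ∈ K
      induction hc using Submodule.span_induction with
      | mem c h =>
        obtain ⟨x, y, rfl⟩ := h
        refine Submodule.le_topologicalClosure _ (Submodule.subset_span
          ⟨X.lsmul e x, X.lsmul_mem_leftSub he x, X.lsmul (star e') y,
            X.lsmul_mem_leftSub (star_mem he') y, ?_⟩)
        rw [X.linner_lsmul, linner_lsmul_right, star_star, mul_assoc]
      | zero => simp
      | add x z _ _ hx hz =>
        rw [mul_add, add_mul]
        exact add_mem hx hz
      | smul c x _ hx =>
        rw [mul_smul_comm, smul_mul_assoc]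
        exact Submodule.smul_mem _ _ hx
    obtain ⟨l, hl, he1, he2, -⟩ := exists_approxUnit ↥I
    have h1 : ∀ e ∈ I, e * a ∈ K := fun e he =>
      hKc.mem_of_tendsto ((continuous_subtype_val.tendsto _).comp
        (he1 ⟨e * a, I.mul_mem_left e ha⟩)) (Eventually.of_forall fun e' => key e he e' e'.2)
    exact hKc.mem_of_tendsto ((continuous_subtype_val.tendsto _).comp (he2 ⟨a, ha⟩))
      (Eventually.of_forall fun e => h1 e e.2)

theorem closure_span_rinner_rightSub (J : ClosedIdeal B) :
    ((Submodule.span ℂ {a | ∃ y ∈ X.rightSub J, ∃ z ∈ X.rightSub J,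
      a = X.rinner y z}).topologicalClosure : Set B) = J := by
  set K := (Submodule.span ℂ {a | ∃ y ∈ X.rightSub J, ∃ z ∈ X.rightSub J,
    a = X.rinner y z}).topologicalClosure with hK
  have hKc : IsClosed (K : Set B) := Submodule.isClosed_topologicalClosure _
  apply Set.Subset.antisymm
  · refine closure_minimal (fun a ha => ?_) J.isClosed'
    induction ha using Submodule.span_induction with
    | mem a h =>
      obtain ⟨y, hy, z, hz, rfl⟩ := h
      exact X.rinner_mem hy hz
    | zero => exact zero_mem J
    | add x z _ _ hx hz => exact add_mem hx hz
    | smul c x _ hx => exact SMulMemClass.smul_mem c hx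
  · intro a ha
    have key : ∀ e ∈ J, ∀ e' ∈ J, e * a * e' ∈ K := by
      intro e he e' he'
      have hfull : a ∈ (Submodule.span ℂ {a | ∃ x y, a = X.rinner x y}).topologicalClosure := by
        rw [X.right_full]
        trivial
      have hcont : Continuous fun a : B => e * a * e' := by fun_prop
      refine hKc.closure_subset (map_mem_closure (f := fun a => e * a * e') hcont hfull
        (t := (K : Set B)) fun c hc => ?_)
      change e * c * e' ∈ K
      induction hc using Submodule.span_induction with
      | mem c h =>
        obtain ⟨x, y, rfl⟩ := h
        refine Submodule.le_topologicalClosure _ (Submodule.subset_span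
          ⟨X.rsmul x (star e), X.rsmul_mem_rightSub x (star_mem he), X.rsmul y e',
            X.rsmul_mem_rightSub y he', ?_⟩)
        rw [X.rinner_rsmul, rinner_rsmul_left, star_star]
      | zero => simp
      | add x z _ _ hx hz =>
        rw [mul_add, add_mul]
        exact add_mem hx hz
      | smul c x _ hx =>
        rw [mul_smul_comm, smul_mul_assoc]
        exact Submodule.smul_mem _ _ hx
    obtain ⟨l, hl, he1, he2, -⟩ := exists_approxUnit ↥J
    have h1 : ∀ e ∈ J, e * a ∈ K := fun e he =>
      hKc.mem_of_tendsto ((continuous_subtype_val.tendsto _).comp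
        (he1 ⟨e * a, J.mul_mem_left e ha⟩)) (Eventually.of_forall fun e' => key e he e' e'.2)
    exact hKc.mem_of_tendsto ((continuous_subtype_val.tendsto _).comp (he2 ⟨a, ha⟩))
      (Eventually.of_forall fun e => h1 e e.2)

/-! ### Multipliers acting on subspaces -/

theorem lmul_one {I : ClosedIdeal A} {x : X} (hx : x ∈ X.leftSub I) :
    X.lmul (1 : 𝓜(ℂ, I)) x = x := by
  have h := X.lmul_spec (1 : 𝓜(ℂ, I)) hx
  refine X.eq_of_lsmul_eq h.1 hx fun a ha => ?_
  rw [h.2 a ha, mulRight_of_mem _ ha]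
  rfl

theorem rmul_one {J : ClosedIdeal B} {x : X} (hx : x ∈ X.rightSub J) :
    X.rmul x (1 : 𝓜(ℂ, J)) = x := by
  have h := X.rmul_spec (1 : 𝓜(ℂ, J)) hx
  refine X.eq_of_rsmul_eq h.1 hx fun b hb => ?_
  rw [h.2 b hb, mulLeft_of_mem _ hb]
  rfl

/-- On `I' · X` with `I' ≤ I`, a multiplier of `I` acts as its restriction to `I'`: multiplying
by `a ∈ I` and then by `c ∈ I'` moves `c a` into `I'`, where both actions agree. -/
theorem lmul_restrict {I I' : ClosedIdeal A} (h : I' ≤ I) (m : 𝓜(ℂ, I)) {x : X}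
    (hx : x ∈ X.leftSub I') : X.lmul (restrictMultiplier h m) x = X.lmul m x := by
  have hx' := X.leftSub_mono h hx
  obtain ⟨h1, h2⟩ := X.lmul_spec (restrictMultiplier h m) hx
  obtain ⟨h3, h4⟩ := X.lmul_spec m hx'
  refine X.eq_of_lsmul_eq (X.leftSub_mono h h1) h3 fun a ha => ?_
  rw [h4 a ha]
  refine X.eq_of_lsmul_eq (X.lsmul_mem_leftSub_of_mem a h1)
    (X.lsmul_mem_leftSub_of_mem _ hx) fun c hc => ?_
  have hca : c * a ∈ I' := I'.mul_mem_right a hc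
  rw [← X.mul_lsmul, h2 _ hca, ← X.mul_lsmul, mulRight_of_mem _ hca, mulRight_of_mem _ ha]
  exact congrArg (fun t : I => X.lsmul (t : A) x) (snd_mul m ⟨c, h hc⟩ ⟨a, ha⟩)

theorem rmul_restrict {J J' : ClosedIdeal B} (h : J' ≤ J) (m : 𝓜(ℂ, J)) {x : X}
    (hx : x ∈ X.rightSub J') : X.rmul x (restrictMultiplier h m) = X.rmul x m := by
  have hx' := X.rightSub_mono h hx
  obtain ⟨h1, h2⟩ := X.rmul_spec (restrictMultiplier h m) hx
  obtain ⟨h3, h4⟩ := X.rmul_spec m hx'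
  refine X.eq_of_rsmul_eq (X.rightSub_mono h h1) h3 fun b hb => ?_
  rw [h4 b hb]
  refine X.eq_of_rsmul_eq (X.rsmul_mem_rightSub_of_mem h1 b)
    (X.rsmul_mem_rightSub_of_mem hx _) fun c hc => ?_
  have hbc : b * c ∈ J' := J'.mul_mem_left b hc
  rw [← X.rsmul_mul, h2 _ hbc, ← X.rsmul_mul, mulLeft_of_mem _ hbc, mulLeft_of_mem _ hb]
  exact congrArg (fun t : J => X.rsmul x (t : B)) (fst_mul m ⟨b, hb⟩ ⟨c, h hc⟩)

/-! ### Imprimitivity subbimodules and partial automorphisms -/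

/-- Fullness over `I` and `J` is automatic for the subbimodule `I · X = X · J`. -/
theorem isImprimitivitySubbimodule_leftSub {I : ClosedIdeal A} {J : ClosedIdeal B}
    (h : X.leftSub I = X.rightSub J) :
    X.IsImprimitivitySubbimodule I (X.leftSub I) J where
  isClosed := Submodule.isClosed_topologicalClosure _
  lsmul_mem a _ hy := X.lsmul_mem_leftSub_of_mem a hy
  rsmul_mem y hy b := by
    rw [h] at hy ⊢
    exact X.rsmul_mem_rightSub_of_mem hy b
  left_span := X.closure_span_linner_leftSub I
  right_span := by
    rw [h]
    exact X.closure_span_rinner_rightSub J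

variable {X}

namespace IsPartialAutomorphism

variable {I I' : ClosedIdeal A} {J J' : ClosedIdeal B} {α : I ≃⋆ₐ[ℂ] I'} {β : J ≃⋆ₐ[ℂ] J'}
  {φ : PartialEquiv X X}

theorem map_mem_leftSub_iff {Y Y' : Submodule ℂ X} (h : X.IsPartialAutomorphism Y Y' α φ β)
    {x : X} (hx : x ∈ Y) {K : ClosedIdeal A} :
    φ x ∈ X.leftSub K ↔ apply α (X.linner x x) ∈ K := by
  rw [mem_leftSub_iff, h.map_linner x hx x hx]

/-- A partial automorphism restricts to `I₀ · X` as soon as `α` and `β` restrict to isomorphisms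
`I₀ → I₀'` and `J₀ → J₀'`; its image is then `I₀' · X`. -/
theorem restr (h : X.IsPartialAutomorphism (X.leftSub I) (X.leftSub I') α φ β)
    {I₀ I₀' : ClosedIdeal A} {J₀ J₀' : ClosedIdeal B} (hI : I₀ ≤ I) (hJ : J₀ ≤ J)
    {α₀ : I₀ ≃⋆ₐ[ℂ] I₀'} {β₀ : J₀ ≃⋆ₐ[ℂ] J₀'}
    (hα : ∀ a ∈ I₀, apply α₀ a = apply α a) (hβ : ∀ b ∈ J₀, apply β₀ b = apply β b)
    (hX : X.leftSub I₀ = X.rightSub J₀) (hX' : X.leftSub I₀' = X.rightSub J₀') :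
    X.IsPartialAutomorphism (X.leftSub I₀) (X.leftSub I₀') α₀
      (φ.restr (X.leftSub I₀ : Set X)) β₀ where
  source_sub := X.isImprimitivitySubbimodule_leftSub hX
  target_sub := X.isImprimitivitySubbimodule_leftSub hX'
  source_eq := by
    rw [PartialEquiv.restr_source, h.source_eq]
    exact Set.inter_eq_right.2 (X.leftSub_mono hI)
  target_eq := by
    have hI' : I₀' ≤ I' := fun a ha => by
      obtain ⟨b, hb⟩ := EquivLike.surjective α₀ ⟨a, ha⟩
      have h1 := hα b b.2
      rw [apply_of_mem _ b.2, hb, apply_of_mem _ (hI b.2)] at h1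
      rw [show a = _ from h1]
      exact Subtype.property _
    ext y
    rw [PartialEquiv.restr_target, h.target_eq]
    change y ∈ X.leftSub I' ∧ φ.symm y ∈ X.leftSub I₀ ↔ y ∈ X.leftSub I₀'
    have aux : ∀ y ∈ X.leftSub I', (φ.symm y ∈ X.leftSub I₀ ↔ y ∈ X.leftSub I₀') := by
      intro y hy
      have hyt : y ∈ φ.target := by rw [h.target_eq]; exact hy
      have hxs : φ.symm y ∈ X.leftSub I := by
        have := φ.map_target hyt
        rwa [h.source_eq] at this
      have h1 := h.map_mem_leftSub_iff hxs (K := I₀')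
      rw [φ.right_inv hyt] at h1
      rw [h1, mem_leftSub_iff]
      have hc := X.mem_leftSub_iff.1 hxs
      constructor
      · intro hm
        rw [← hα _ hm, apply_of_mem _ hm]
        exact Subtype.property _
      · intro hm
        obtain ⟨b, hb⟩ := EquivLike.surjective α₀ ⟨_, hm⟩
        have h2 := hα b b.2
        rw [apply_of_mem _ b.2, hb] at h2
        change apply α _ = _ at h2
        rw [apply_of_mem _ hc, apply_of_mem _ (hI b.2)] at h2
        have h3 := congrArg Subtype.val (EquivLike.injective α (Subtype.ext h2))
        rw [show X.linner (φ.symm y) (φ.symm y) = b from h3]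
        exact b.2
    exact ⟨fun hy => (aux y hy.1).1 hy.2,
      fun hy => ⟨X.leftSub_mono hI' hy, (aux y (X.leftSub_mono hI' hy)).2 hy⟩⟩
  map_rsmul x hx b hb := by
    rw [hβ b hb]
    exact h.map_rsmul x (X.leftSub_mono hI hx) b (hJ hb)
  map_rinner x hx y hy := by
    rw [hβ _ (X.rinner_mem (hX ▸ hx) (hX ▸ hy))]
    exact h.map_rinner x (X.leftSub_mono hI hx) y (X.leftSub_mono hI hy)
  map_lsmul a ha x hx := by
    rw [hα a ha]
    exact h.map_lsmul a (hI ha) x (X.leftSub_mono hI hx)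
  map_linner x hx y hy := by
    rw [hα _ (X.linner_mem hx hy)]
    exact h.map_linner x (X.leftSub_mono hI hx) y (X.leftSub_mono hI hy)

/-- Transport along equalities of ideals. -/
theorem congr (h : X.IsPartialAutomorphism (X.leftSub I) (X.leftSub I') α φ β)
    {I₀ I₀' : ClosedIdeal A} {J₀ J₀' : ClosedIdeal B} (hI : I = I₀) (hI' : I' = I₀')
    (hJ : J = J₀) (hJ' : J' = J₀') {α₀ : I₀ ≃⋆ₐ[ℂ] I₀'} {β₀ : J₀ ≃⋆ₐ[ℂ] J₀'}
    (hα : ∀ a ∈ I₀, apply α a = apply α₀ a) (hβ : ∀ b ∈ J₀, apply β b = apply β₀ b) :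
    X.IsPartialAutomorphism (X.leftSub I₀) (X.leftSub I₀') α₀ φ β₀ := by
  subst hI hI' hJ hJ'
  have hα' : apply α₀ = apply α := funext fun a => by
    by_cases ha : a ∈ I
    · exact (hα a ha).symm
    · rw [apply, apply, dif_neg ha, dif_neg ha]
  have hβ' : apply β₀ = apply β := funext fun b => by
    by_cases hb : b ∈ J
    · exact (hβ b hb).symm
    · rw [apply, apply, dif_neg hb, dif_neg hb]
  exact
    { source_sub := h.source_sub
      target_sub := h.target_sub
      source_eq := h.source_eq
      target_eq := h.target_eq
      map_rsmul := by rw [hβ']; exact h.map_rsmul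
      map_rinner := by rw [hβ']; exact h.map_rinner
      map_lsmul := by rw [hα']; exact h.map_lsmul
      map_linner := by rw [hα']; exact h.map_linner }

end IsPartialAutomorphism

end ImprimitivityBimodule

/-! ### From partial actions of `G` to actions of `S(G)` -/

section

variable {G : Type*} [Group G] {A : Type u} [NonUnitalCStarAlgebra A]
  {B : Type v} [NonUnitalCStarAlgebra B]
  {α : TwistedPartialAction G A} {μ : TwistedPartialAction G B}
  {X : ImprimitivityBimodule.{u, v, w} A B}

namespace ExelSemigroup

@[simp] theorem supp_bracket (s : G) : (bracket s).supp = {1, s} := rfl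
@[simp] theorem elt_bracket (s : G) : (bracket s).elt = s := rfl

theorem star_bracket (s : G) : star (bracket s) = bracket s⁻¹ := by
  ext1
  · simp [Set.smul_set_insert, Set.pair_comm]
  · rfl

theorem word_cons (g : G) (l : List G) (s : G) :
    word (g :: l) s = bracket g * bracket g⁻¹ * word l s := by
  simp [word, mul_assoc]

theorem word_nil (s : G) : word [] s = bracket s := by
  simp [word]

theorem elt_word (l : List G) (s : G) : (word l s).elt = s := by
  induction l with
  | nil => rw [word_nil, elt_bracket]
  | cons g l ih => simp [word_cons, ih]

theorem supp_word_cons (g : G) (l : List G) (s : G) :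
    (word (g :: l) s).supp = insert g (word l s).supp := by
  ext h
  have h1 := (word l s).one_mem
  simp only [word_cons, supp_mul, elt_mul, supp_bracket, elt_bracket, mul_inv_cancel, one_smul,
    Set.smul_set_insert, Set.smul_set_singleton, smul_eq_mul, mul_one, Set.mem_union,
    Set.mem_insert_iff, Set.mem_singleton_iff]
  constructor
  · rintro (((rfl | rfl) | (rfl | rfl)) | h)
    all_goals tauto
  · tauto

/-- `[s][t]` is a restriction of `[st]`. -/
theorem bracket_mul_bracket (s t : G) :
    bracket s * bracket t = bracket s * bracket s⁻¹ * bracket (s * t) := by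
  ext1
  · ext g
    simp [Set.smul_set_insert]
  · simp

theorem isIdempotentElem_bracket (s : G) :
    IsIdempotentElem (bracket s * bracket s⁻¹) := by
  refine ExelSemigroup.ext ?_ ?_ <;> simp

end ExelSemigroup

open ExelSemigroup

namespace TwistedPartialAction

theorem semigroupIdeal_bracket (α : TwistedPartialAction G A) (s : G) :
    α.semigroupIdeal (bracket s) = α.ideal s := by
  refine SetLike.ext fun a => ?_
  simp [mem_semigroupIdeal, α.ideal_one]

theorem semigroupIdeal_star_bracket (α : TwistedPartialAction G A) (s : G) :
    α.semigroupIdeal (star (bracket s)) = α.ideal s⁻¹ := by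
  rw [star_bracket, semigroupIdeal_bracket]

theorem semigroupIdeal_star_bracket_mul_bracket (α : TwistedPartialAction G A) (s t : G) :
    α.semigroupIdeal (star (bracket s * bracket t)) =
      α.ideal (t⁻¹ * s⁻¹) ⊓ α.ideal t⁻¹ := by
  refine SetLike.ext fun a => ?_
  simp [mem_semigroupIdeal_star, Set.smul_set_insert, or_imp, forall_and, α.ideal_one]

theorem lmul_semigroupTwist (α : TwistedPartialAction G A) (p q : ExelSemigroup G) {x : X}
    (hx : x ∈ X.leftSub (α.semigroupIdeal (p * q))) :
    X.lmul (α.semigroupTwist p q : 𝓜(ℂ, α.semigroupIdeal (p * q))) x =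
      X.lmul (α.twist p.elt q.elt :
        𝓜(ℂ, ↥(α.ideal p.elt ⊓ α.ideal (p.elt * q.elt)))) x :=
  X.lmul_restrict (α.semigroupIdeal_mul_le p q) _ hx

theorem rmul_star_semigroupTwist (μ : TwistedPartialAction G B) (p q : ExelSemigroup G) {x : X}
    (hx : x ∈ X.rightSub (μ.semigroupIdeal (p * q))) :
    X.rmul x (star (μ.semigroupTwist p q : 𝓜(ℂ, μ.semigroupIdeal (p * q)))) =
      X.rmul x (star (μ.twist p.elt q.elt :
        𝓜(ℂ, ↥(μ.ideal p.elt ⊓ μ.ideal (p.elt * q.elt))))) :=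
  X.rmul_restrict (μ.semigroupIdeal_mul_le p q) (star (μ.twist p.elt q.elt).1) hx

/-- On `A_{pq} · X = X · B_{pq}`, conjugating by the multipliers of the action of `S(G)` is
conjugating by those of the partial action of `G`. -/
theorem rmul_lmul_semigroupTwist {p q : ExelSemigroup G}
    (h : X.leftSub (α.semigroupIdeal (p * q)) = X.rightSub (μ.semigroupIdeal (p * q))) {x : X}
    (hx : x ∈ X.leftSub (α.semigroupIdeal (p * q))) :
    X.rmul (X.lmul (α.semigroupTwist p q : 𝓜(ℂ, α.semigroupIdeal (p * q))) x)
        (star (μ.semigroupTwist p q : 𝓜(ℂ, μ.semigroupIdeal (p * q)))) =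
      X.rmul (X.lmul (α.twist p.elt q.elt :
          𝓜(ℂ, ↥(α.ideal p.elt ⊓ α.ideal (p.elt * q.elt)))) x)
        (star (μ.twist p.elt q.elt : 𝓜(ℂ, ↥(μ.ideal p.elt ⊓ μ.ideal (p.elt * q.elt))))) := by
  have hz := (X.lmul_spec (α.semigroupTwist p q : 𝓜(ℂ, α.semigroupIdeal (p * q))) hx).1
  rw [h] at hz
  rw [rmul_star_semigroupTwist μ p q hz, lmul_semigroupTwist α p q hx]

namespace IsMoritaEquivalence

variable {φ : G → PartialEquiv X X}

theorem leftSub_semigroupIdeal (h : α.IsMoritaEquivalence μ X φ) (p : ExelSemigroup G) :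
    X.leftSub (α.semigroupIdeal p) = X.rightSub (μ.semigroupIdeal p) :=
  X.leftSub_inter_eq_rightSub_inter fun g => h.sub_eq g

end IsMoritaEquivalence

/-- The partial bijection attached to `p ∈ S(G)`: the restriction of `φ_s`, where `s` is the
last letter of the canonical form of `p`, to `A_{p*} · X`. -/
def semigroupMap (α : TwistedPartialAction G A) (φ : G → PartialEquiv X X)
    (p : ExelSemigroup G) : PartialEquiv X X :=
  (φ p.elt).restr (X.leftSub (α.semigroupIdeal (star p)) : Set X)

namespace IsMoritaEquivalence

variable {φ : G → PartialEquiv X X}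

theorem partialAut_semigroupMap (h : α.IsMoritaEquivalence μ X φ) (p : ExelSemigroup G) :
    X.IsPartialAutomorphism (X.leftSub (α.semigroupIdeal (star p)))
      (X.leftSub (α.semigroupIdeal p)) (α.semigroupAct p) (α.semigroupMap φ p)
      (μ.semigroupAct p) :=
  (h.partialAut p.elt).restr (α.semigroupIdeal_star_le p) (μ.semigroupIdeal_star_le p)
    (fun _ ha => α.apply_semigroupAct p ha) (fun _ hb => μ.apply_semigroupAct p hb)
    (h.leftSub_semigroupIdeal (star p)) (h.leftSub_semigroupIdeal p)

/-- A Morita equivalence of twisted partial actions extends to `S(G)` on the same bimodule. -/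
theorem toBusbySmith (h : α.IsMoritaEquivalence μ X φ) :
    α.toBusbySmith.IsMoritaEquivalence μ.toBusbySmith X (α.semigroupMap φ) where
  sub_eq := h.leftSub_semigroupIdeal
  partialAut := h.partialAut_semigroupMap
  comp_source p q := by
    ext x
    have hp := (h.partialAut_semigroupMap p).source_eq
    have hq := (h.partialAut_semigroupMap q).source_eq
    have hpq := (h.partialAut_semigroupMap (p * q)).source_eq
    rw [PartialEquiv.trans_source, hpq, hq, hp]
    change x ∈ X.leftSub _ ∧ α.semigroupMap φ q x ∈ X.leftSub _ ↔ x ∈ X.leftSub _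
    rw [X.mem_leftSub_iff (I := α.semigroupIdeal (star (p * q))), α.semigroup_act_dom,
      ← X.mem_leftSub_iff]
    exact and_congr_right fun hx => (h.partialAut_semigroupMap q).map_mem_leftSub_iff hx
  comp p q x hx := by
    have hP := h.partialAut_semigroupMap (p * q)
    have hx' : x ∈ X.leftSub (α.semigroupIdeal (star (p * q))) := by
      have := hx
      rwa [hP.source_eq] at this
    have hy : φ (p.elt * q.elt) x ∈ X.leftSub (α.semigroupIdeal (p * q)) := by
      have := (α.semigroupMap φ (p * q)).map_source hx
      rwa [hP.target_eq] at this
    have hle : μ.semigroupIdeal (star (p * q)) ≤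
        μ.ideal (q.elt⁻¹ * p.elt⁻¹) ⊓ μ.ideal q.elt⁻¹ := fun b hb => by
      refine ⟨by simpa using μ.semigroupIdeal_star_le (p * q) hb, ?_⟩
      exact μ.semigroupIdeal_star_le q ((μ.semigroup_act_dom p q b).1 hb).1
    have key := h.comp p.elt q.elt x (X.rightSub_mono hle (h.leftSub_semigroupIdeal _ ▸ hx'))
    exact key.trans (rmul_lmul_semigroupTwist (h.leftSub_semigroupIdeal _) hy).symm

/-- The restriction of `φ_s` agrees with the composition `φ_{g₁} φ_{g₁}⁻¹ ⋯ φ_{gₘ} φ_{gₘ}⁻¹ φ_s`: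
each factor `φ_g φ_g⁻¹` is the identity of `A_g · X`, and `φ_s x ∈ A_g · X` means
`⟨x, x⟩ ∈ A_{s⁻¹ g}`. -/
theorem semigroupMap_word (h : α.IsMoritaEquivalence μ X φ) (l : List G) (s : G) :
    (α.semigroupMap φ (word l s)).EqOnSource (wordComp φ l s) := by
  have hs := h.partialAut s
  have hsrc : ∀ l, (α.semigroupMap φ (word l s)).source =
      X.leftSub (α.semigroupIdeal (star (word l s))) :=
    fun l => (h.partialAut_semigroupMap _).source_eq
  have hval : ∀ l x, α.semigroupMap φ (word l s) x = φ s x := fun l x => by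
    change φ (word l s).elt x = _
    rw [elt_word]
  induction l with
  | nil =>
    refine ⟨?_, fun x _ => hval [] x⟩
    rw [hsrc, word_nil, semigroupIdeal_star_bracket]
    exact hs.source_eq.symm
  | cons g l ih =>
    have hg := (h.partialAut g).target_eq
    have hdom : ∀ x, x ∈ (α.semigroupMap φ (word (g :: l) s)).source ↔
        x ∈ (α.semigroupMap φ (word l s)).source ∧ φ s x ∈ X.leftSub (α.ideal g) := by
      intro x
      rw [hsrc, hsrc, SetLike.mem_coe, SetLike.mem_coe, X.mem_leftSub_iff, X.mem_leftSub_iff,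
        α.mem_semigroupIdeal_star, α.mem_semigroupIdeal_star, supp_word_cons,
        Set.forall_mem_insert, and_comm]
      simp only [elt_word]
      refine and_congr_right fun hx => ?_
      have hx1 : X.linner x x ∈ α.ideal s⁻¹ := by simpa using hx 1 (one_mem _)
      rw [hs.map_mem_leftSub_iff (X.mem_leftSub_iff.2 hx1), apply_of_mem _ hx1, act_mem_iff]
    have hcons : wordComp φ (g :: l) s = (wordComp φ l s).trans ((φ g).symm.trans (φ g)) := rfl
    have hmem : ∀ x, x ∈ (wordComp φ (g :: l) s).source ↔
        x ∈ (wordComp φ l s).source ∧ wordComp φ l s x ∈ X.leftSub (α.ideal g) := by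
      intro x
      rw [hcons, PartialEquiv.trans_source, (PartialEquiv.symm_trans_self _).source_eq]
      change _ ∧ wordComp φ l s x ∈ (φ g).target ↔ _
      rw [hg]
      rfl
    have hsource : (α.semigroupMap φ (word (g :: l) s)).source =
        (wordComp φ (g :: l) s).source := by
      ext x
      rw [hdom, hmem, ← ih.1]
      refine and_congr_right fun hx => ?_
      rw [← ih.2 hx, hval]
    refine ⟨hsource, fun x hx => ?_⟩
    have hx1 := (hdom x).1 hx
    have hgx : φ s x ∈ (φ g).target := by
      rw [hg]
      exact hx1.2
    change _ = φ g ((φ g).symm (wordComp φ l s x))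
    rw [← ih.2 hx1.1, hval, hval, (φ g).right_inv hgx]

end IsMoritaEquivalence
end TwistedPartialAction

/-! ### From actions of `S(G)` to partial actions of `G` -/

namespace BusbySmithAction.IsMoritaEquivalence

variable {S : Type*} [InverseMonoid S] {γ : BusbySmithAction S A} {δ : BusbySmithAction S B}
  {ψ : S → PartialEquiv X X}

theorem comp_of_isIdempotentElem (h : γ.IsMoritaEquivalence δ X ψ) {s t : S}
    (hst : IsIdempotentElem s ∨ IsIdempotentElem t) {x : X} (hx : x ∈ (ψ (s * t)).source) :
    ψ s (ψ t x) = ψ (s * t) x := by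
  have hy := (ψ (s * t)).map_source hx
  rw [(h.partialAut (s * t)).target_eq, SetLike.mem_coe] at hy
  rw [h.comp s t x hx, γ.twist_idem s t hst, δ.twist_idem s t hst]
  simp only [OneMemClass.coe_one, star_one]
  rw [X.lmul_one hy, X.rmul_one (h.sub_eq _ ▸ hy)]

/-- `ψ_e` is an injective idempotent partial map, hence an identity map. -/
theorem apply_of_isIdempotentElem (h : γ.IsMoritaEquivalence δ X ψ) {e : S}
    (he : IsIdempotentElem e) {x : X} (hx : x ∈ (ψ e).source) : ψ e x = x := by
  have hx' : x ∈ (ψ (e * e)).source := by rwa [he.eq]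
  have h1 := h.comp_of_isIdempotentElem (Or.inl he) hx'
  rw [he.eq] at h1
  rw [← h.comp_source] at hx'
  exact (ψ e).injOn hx'.2 hx h1

/-- Multiplying by an idempotent restricts the partial map. -/
theorem apply_idem_mul (h : γ.IsMoritaEquivalence δ X ψ) {e : S} (he : IsIdempotentElem e)
    (t : S) {x : X} (hx : x ∈ (ψ (e * t)).source) : ψ (e * t) x = ψ t x := by
  rw [← h.comp_of_isIdempotentElem (Or.inl he) hx]
  rw [← h.comp_source] at hx
  exact h.apply_of_isIdempotentElem he hx.2

end BusbySmithAction.IsMoritaEquivalence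

/-- The maps at the generators `[s]` form a Morita equivalence of twisted partial actions. -/
theorem TwistedPartialAction.IsMoritaEquivalence.of_toBusbySmith
    {ψ : ExelSemigroup G → PartialEquiv X X}
    (h : α.toBusbySmith.IsMoritaEquivalence μ.toBusbySmith X ψ) :
    α.IsMoritaEquivalence μ X fun s => ψ (bracket s) where
  sub_eq s := by
    rw [← α.semigroupIdeal_bracket, ← μ.semigroupIdeal_bracket]
    exact h.sub_eq _
  partialAut s := by
    have hP : X.IsPartialAutomorphism (X.leftSub (α.semigroupIdeal (star (bracket s))))
        (X.leftSub (α.semigroupIdeal (bracket s))) (α.semigroupAct (bracket s)) (ψ (bracket s))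
        (μ.semigroupAct (bracket s)) := h.partialAut (bracket s)
    refine hP.congr (α.semigroupIdeal_star_bracket s) (α.semigroupIdeal_bracket s)
      (μ.semigroupIdeal_star_bracket s) (μ.semigroupIdeal_bracket s) (fun a ha => ?_)
      fun b hb => ?_
    · rw [← α.semigroupIdeal_star_bracket] at ha
      exact α.apply_semigroupAct _ ha
    · rw [← μ.semigroupIdeal_star_bracket] at hb
      exact μ.apply_semigroupAct _ hb
  comp s t x hx := by
    have hX : ∀ p, X.leftSub (α.semigroupIdeal p) = X.rightSub (μ.semigroupIdeal p) := h.sub_eq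
    rw [← μ.semigroupIdeal_star_bracket_mul_bracket, ← hX] at hx
    have hP := h.partialAut (bracket s * bracket t)
    have hsrc : x ∈ (ψ (bracket s * bracket t)).source := by
      rw [hP.source_eq]
      exact hx
    have hval : ψ (bracket s * bracket t) x = ψ (bracket (s * t)) x := by
      have hsrc' := hsrc
      rw [bracket_mul_bracket] at hsrc' ⊢
      exact h.apply_idem_mul (isIdempotentElem_bracket s) _ hsrc'
    have hy : ψ (bracket (s * t)) x ∈ X.leftSub (α.semigroupIdeal (bracket s * bracket t)) := by
      have := (ψ (bracket s * bracket t)).map_source hsrc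
      rw [hP.target_eq, hval] at this
      exact this
    have key := h.comp (bracket s) (bracket t) x hsrc
    rw [hval] at key
    exact key.trans (TwistedPartialAction.rmul_lmul_semigroupTwist (hX _) hy)

end

end MoritaActions

theorem mainTheorem9 {G : Type*} [Group G] {A : Type*} [NonUnitalCStarAlgebra A]
    {B : Type*} [NonUnitalCStarAlgebra B]
    (α : MoritaActions.TwistedPartialAction G A) (μ : MoritaActions.TwistedPartialAction G B) :
    (α.MoritaEquivalent μ ↔ α.toBusbySmith.MoritaEquivalent μ.toBusbySmith) ∧
    ∀ (X : MoritaActions.ImprimitivityBimodule A B) (φ : G → PartialEquiv X X),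
      α.IsMoritaEquivalence μ X φ →
        ∃ ψ : MoritaActions.ExelSemigroup G → PartialEquiv X X,
          α.toBusbySmith.IsMoritaEquivalence μ.toBusbySmith X ψ ∧
          ∀ (l : List G) (s : G),
            (ψ (MoritaActions.ExelSemigroup.word l s)).EqOnSource
              (MoritaActions.wordComp φ l s) := by
  refine ⟨⟨?_, ?_⟩, fun X φ h => ⟨α.semigroupMap φ, h.toBusbySmith, h.semigroupMap_word⟩⟩
  · rintro ⟨X, φ, h⟩
    exact ⟨X, α.semigroupMap φ, h.toBusbySmith⟩
  · rintro ⟨X, ψ, h⟩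
    exact ⟨X, _, MoritaActions.TwistedPartialAction.IsMoritaEquivalence.of_toBusbySmith h⟩
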